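/- There are a deterministic algorithm $P$ on the real RAM and an absolute constant $C$ such that the following holds for all integers $d \ge 1$ and $n \ge 2$ and all real $\varepsilon$ with $0 < \varepsilon < 1$. Let $R$ be an axis-parallel $d$-dimensional closed hypercube in $\mathbb{R}^d$ with positive side length, and let $n$ points in $R$ be given. An empty hypercube is an open axis-parallel hypercube of positive side length that is contained in $R$ and contains none of the $n$ points. On input $n$, $d$, $\varepsilon$, $R$ (its lowest corner and side length) and the coordinates of the points, $P$ halts and returns the lowest corner and the side length of an empty hypercube whose volume is at least $1-\varepsilon$ times the maximum volume of an empty hypercube, and its running time is at most $$ C\left( \frac{d^2}{\varepsilon}\, n \log_2 n + \left(\frac{4d}{\varepsilon}\right)^{d+1} n^{1/d} \log_2 n \right). $$ Here the real RAM is the machine with real-valued registers and a random access memory of real-valued cells, whose programs are finite and use only integer constants, and on which each arithmetic operation $+,-,\times,/$, each floor operation, each comparison of real numbers and each memory access takes one unit of time. -/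

import Mathlib

/-! ## Geometry: axis-parallel hypercubes in `ℝ^d` -/

/-- The closed axis-parallel hypercube with lowest corner `c` and side length `s`. -/
def closedCube {d : ℕ} (c : Fin d → ℝ) (s : ℝ) : Set (Fin d → ℝ) :=
  {p | ∀ i, c i ≤ p i ∧ p i ≤ c i + s}

/-- The open axis-parallel hypercube with lowest corner `c` and side length `s`. -/
def openCube {d : ℕ} (c : Fin d → ℝ) (s : ℝ) : Set (Fin d → ℝ) :=
  {p | ∀ i, c i < p i ∧ p i < c i + s}

/-- `(c, s)` describes an empty hypercube for the points `x` in `R = closedCube a L`: a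
(nondegenerate) open axis-parallel hypercube that lies in `R` and contains none of the points. -/
def IsEmptyHypercube {d n : ℕ} (a : Fin d → ℝ) (L : ℝ) (x : Fin n → Fin d → ℝ)
    (c : Fin d → ℝ) (s : ℝ) : Prop :=
  0 < s ∧ openCube c s ⊆ closedCube a L ∧ ∀ j, x j ∉ openCube c s

/-- `(c, s)` describes a `(1 - ε)`-approximation of a maximum-volume empty hypercube: it is an
empty hypercube whose volume is at least `1 - ε` times that of every empty hypercube. -/
def IsApproxMaxEmptyHypercube {d n : ℕ} (ε : ℝ) (a : Fin d → ℝ) (L : ℝ)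
    (x : Fin n → Fin d → ℝ) (c : Fin d → ℝ) (s : ℝ) : Prop :=
  IsEmptyHypercube a L x c s ∧
    ∀ (c' : Fin d → ℝ) (s' : ℝ), IsEmptyHypercube a L x c' s' →
      ENNReal.ofReal (1 - ε) * MeasureTheory.volume (openCube c' s') ≤
        MeasureTheory.volume (openCube c s)

/-! ## The unit-cost real RAM with floor function

Programs are finite and contain only integer constants. They work on registers (a fixed program
names only finitely many of them) and on an infinite random access memory; every register and
every memory cell holds a real number. Each arithmetic operation, floor, memory access,
comparison, constant and register access costs one unit of time. -/

namespace RealRAM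

/-- A machine state: the registers and the random access memory. -/
structure State where
  reg : ℕ → ℝ
  mem : ℕ → ℝ

/-- Expressions. `load e` reads the memory cell whose address is the value of `e`. -/
inductive Expr where
  | const (z : ℤ)
  | reg (r : ℕ)
  | load (e : Expr)
  | plus (e₁ e₂ : Expr)
  | minus (e₁ e₂ : Expr)
  | times (e₁ e₂ : Expr)
  | divide (e₁ e₂ : Expr)
  | floor (e : Expr)

/-- The value of an expression. Addresses are rounded down to natural numbers, and dividing by
zero gives zero, so that evaluation is total. -/
noncomputable def Expr.eval (σ : State) : Expr → ℝ
  | .const z => (z : ℝ)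
  | .reg r => σ.reg r
  | .load e => σ.mem ⌊e.eval σ⌋₊
  | .plus e₁ e₂ => e₁.eval σ + e₂.eval σ
  | .minus e₁ e₂ => e₁.eval σ - e₂.eval σ
  | .times e₁ e₂ => e₁.eval σ * e₂.eval σ
  | .divide e₁ e₂ => e₁.eval σ / e₂.eval σ
  | .floor e => ((⌊e.eval σ⌋ : ℤ) : ℝ)

/-- The time for evaluating an expression: the number of its nodes. -/
def Expr.cost : Expr → ℕ
  | .const _ => 1
  | .reg _ => 1
  | .load e => e.cost + 1
  | .plus e₁ e₂ => e₁.cost + e₂.cost + 1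
  | .minus e₁ e₂ => e₁.cost + e₂.cost + 1
  | .times e₁ e₂ => e₁.cost + e₂.cost + 1
  | .divide e₁ e₂ => e₁.cost + e₂.cost + 1
  | .floor e => e.cost + 1

/-- Tests: exact comparisons of real numbers. -/
inductive Test where
  | lt (e₁ e₂ : Expr)
  | le (e₁ e₂ : Expr)

/-- The truth value of a test. -/
def Test.Holds (σ : State) : Test → Prop
  | .lt e₁ e₂ => e₁.eval σ < e₂.eval σ
  | .le e₁ e₂ => e₁.eval σ ≤ e₂.eval σ

/-- The time for a test. -/
def Test.cost : Test → ℕ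
  | .lt e₁ e₂ => e₁.cost + e₂.cost + 1
  | .le e₁ e₂ => e₁.cost + e₂.cost + 1

/-- Programs. -/
inductive Program where
  | skip
  | assign (r : ℕ) (e : Expr)
  | store (addr val : Expr)
  | seq (P Q : Program)
  | ite (b : Test) (P Q : Program)
  | loop (b : Test) (P : Program)

/-- `Exec P σ τ t`: started in state `σ`, the program `P` halts in state `τ` after time
exactly `t`. The program `loop b P` runs `P` as long as the test `b` holds. -/
inductive Exec : Program → State → State → ℕ → Prop where
  | skip (σ : State) : Exec .skip σ σ 1
  | assign (σ : State) (r : ℕ) (e : Expr) :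
      Exec (.assign r e) σ ⟨Function.update σ.reg r (e.eval σ), σ.mem⟩ (e.cost + 1)
  | store (σ : State) (addr val : Expr) :
      Exec (.store addr val) σ
        ⟨σ.reg, Function.update σ.mem ⌊addr.eval σ⌋₊ (val.eval σ)⟩ (addr.cost + val.cost + 1)
  | seq {P Q : Program} {σ τ υ : State} {t u : ℕ} :
      Exec P σ τ t → Exec Q τ υ u → Exec (.seq P Q) σ υ (t + u)
  | ite_true {b : Test} {P Q : Program} {σ τ : State} {t : ℕ} :
      b.Holds σ → Exec P σ τ t → Exec (.ite b P Q) σ τ (b.cost + t)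
  | ite_false {b : Test} {P Q : Program} {σ τ : State} {t : ℕ} :
      ¬ b.Holds σ → Exec Q σ τ t → Exec (.ite b P Q) σ τ (b.cost + t)
  | loop_true {b : Test} {P : Program} {σ τ υ : State} {t u : ℕ} :
      b.Holds σ → Exec P σ τ t → Exec (.loop b P) τ υ u →
        Exec (.loop b P) σ υ (b.cost + t + u)
  | loop_false {b : Test} {P : Program} {σ : State} :
      ¬ b.Holds σ → Exec (.loop b P) σ σ b.cost

/-- The machine is deterministic: the final state and the running time are determined by the
program and the initial state. -/
theorem Exec.deterministic {P : Program} {σ τ τ' : State} {t t' : ℕ}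
    (h : Exec P σ τ t) (h' : Exec P σ τ' t') : τ = τ' ∧ t = t' := by
  induction h generalizing τ' t' with
  | skip => cases h'; exact ⟨rfl, rfl⟩
  | assign => cases h'; exact ⟨rfl, rfl⟩
  | store => cases h'; exact ⟨rfl, rfl⟩
  | seq _ _ ih₁ ih₂ =>
    cases h' with
    | seq k₁ k₂ =>
      obtain ⟨rfl, rfl⟩ := ih₁ k₁
      obtain ⟨rfl, rfl⟩ := ih₂ k₂
      exact ⟨rfl, rfl⟩
  | ite_true hb _ ih =>
    cases h' with
    | ite_true _ k => obtain ⟨rfl, rfl⟩ := ih k; exact ⟨rfl, rfl⟩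
    | ite_false hb' _ => exact absurd hb hb'
  | ite_false hb _ ih =>
    cases h' with
    | ite_true hb' _ => exact absurd hb' hb
    | ite_false _ k => obtain ⟨rfl, rfl⟩ := ih k; exact ⟨rfl, rfl⟩
  | loop_true hb _ _ ih₁ ih₂ =>
    cases h' with
    | loop_true _ k₁ k₂ =>
      obtain ⟨rfl, rfl⟩ := ih₁ k₁
      obtain ⟨rfl, rfl⟩ := ih₂ k₂
      exact ⟨rfl, rfl⟩
    | loop_false hb' => exact absurd hb hb'
  | loop_false hb =>
    cases h' with
    | loop_true hb' _ _ => exact absurd hb' hb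
    | loop_false _ => exact ⟨rfl, rfl⟩

end RealRAM

/-- The initial machine state for the input `(n, d, ε, R, x)` with `R = closedCube a L`: the
registers 0, 1, 2, 3 hold `n`, `d`, `ε`, `L`, and the memory holds the coordinates of `a`,
followed by those of the points `x 0, x 1, …`. Everything else is zero. -/
noncomputable def inputState {d n : ℕ} (ε : ℝ) (a : Fin d → ℝ) (L : ℝ)
    (x : Fin n → Fin d → ℝ) : RealRAM.State where
  reg := fun r => [(n : ℝ), (d : ℝ), ε, L].getD r 0
  mem := fun k =>
    (List.ofFn a ++ (List.ofFn fun j => List.ofFn (x j)).flatten).getD k 0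

/-- The side length of the hypercube that is returned in a final state: register 0. -/
def outputSide (τ : RealRAM.State) : ℝ := τ.reg 0

/-- The lowest corner of the hypercube that is returned in a final state: the first `d` memory
cells. -/
def outputCorner (d : ℕ) (τ : RealRAM.State) : Fin d → ℝ := fun i => τ.mem i

/-!
The registers of the machine hold arbitrary real numbers, and every operation takes one unit of
time, also on integers with very many digits.  The algorithm makes use of this: it packs a weight
for every cube of a grid into one integer, treats all cubes simultaneously by a few arithmetic
operations, and needs only `O(d ^ 2 * n / ε)` units of time.

*The grid.*  Let `G` be the least power of two with `2 * d * (n + 1) ≤ G * ε`, and divide `R` into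
`G ^ d` cells.  Measured in cell widths, an empty cube of side `S` contains a cube of cells, free
of points, of a side greater than `S - 2`, and one of the `n + 1` equal cubes along the diagonal
of `R` is empty and has side at least `2 * d / ε`.  By Bernoulli's inequality a largest cube of
cells that is free of points is therefore a `(1 - ε)`-approximation
(`isApproxMaxEmptyHypercube_of_full`).

*The weights.*  The cube of `s ^ d` cells with topmost cell `w` is encoded by the position
`u = ∑ w i * H ^ i + s * H ^ d`, where `H = 2 * G`, so that `u < B = H ^ (d + 1)`.  It receives a
weight between `0` and `2 * n` that equals `2 * n` if and only if the cube lies in the grid and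
contains no point (`weight_eq_iff`).  The generating function of the weights at an integer `X` is
an expression in geometric sums and in the sum of one monomial for each point
(`packed_weight`); with a table of powers of `X` it takes `O(n * d + G * d)` operations.

*Amplification.*  If `a` is packed in a huge base, then its digits can be squared simultaneously
by a constant number of operations, which leave a packing in a smaller base (`packed_square`).
After `q` rounds each weight is raised to the power `2 ^ q`, where `q = O(log H)` is such that
even `B` weights below `2 * n` have powers with a sum less than `(2 * n) ^ 2 ^ q`
(`exists_separating_power`).  The bases that are needed form a tower in which each one is the
`B`-th power of the one before, and `B` is a power of two.

*The search.*  Now a block of positions contains a position of weight `2 * n` if and only if the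
digit sum of the block is at least `(2 * n) ^ 2 ^ q`, and the digit sum is a remainder
(`packed_mod_pred`).  Hence the digits in base `H` of the last such position are found one after
the other, beginning with the side length `s`, by scanning `H` blocks each
(`RealRAM.searchProg_runs`).  The last position has the largest side length.

All in all this takes `O((d + 1) * H)` units of time, and `(d + 1) * H = O(d ^ 2 * n / ε)`.
-/

/-! ### Reasoning about programs: correctness, running times, frames -/

namespace RealRAM

instance : Add Expr := ⟨Expr.plus⟩
instance : Sub Expr := ⟨Expr.minus⟩
instance : Mul Expr := ⟨Expr.times⟩
instance : Div Expr := ⟨Expr.divide⟩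
instance (k : ℕ) : OfNat Expr k := ⟨Expr.const k⟩

infixr:50 " ;; " => Program.seq
infix:60 " ≔ " => Program.assign

@[simp] theorem Expr.eval_reg (σ : State) (r : ℕ) : (Expr.reg r).eval σ = σ.reg r := rfl
@[simp] theorem Expr.eval_load (σ : State) (e : Expr) :
    (Expr.load e).eval σ = σ.mem ⌊e.eval σ⌋₊ := rfl
@[simp] theorem Expr.eval_floor (σ : State) (e : Expr) :
    (Expr.floor e).eval σ = ((⌊e.eval σ⌋ : ℤ) : ℝ) := rfl
@[simp] theorem Expr.eval_add (σ : State) (e f : Expr) :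
    (e + f).eval σ = e.eval σ + f.eval σ := rfl
@[simp] theorem Expr.eval_sub (σ : State) (e f : Expr) :
    (e - f).eval σ = e.eval σ - f.eval σ := rfl
@[simp] theorem Expr.eval_mul (σ : State) (e f : Expr) :
    (e * f).eval σ = e.eval σ * f.eval σ := rfl
@[simp] theorem Expr.eval_div (σ : State) (e f : Expr) :
    (e / f).eval σ = e.eval σ / f.eval σ := rfl
@[simp] theorem Expr.eval_zero (σ : State) : (0 : Expr).eval σ = 0 := by
  change (((0 : ℕ) : ℤ) : ℝ) = 0; simp
@[simp] theorem Expr.eval_one (σ : State) : (1 : Expr).eval σ = 1 := by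
  change (((1 : ℕ) : ℤ) : ℝ) = 1; simp
@[simp] theorem Expr.eval_two (σ : State) : (2 : Expr).eval σ = 2 := by
  change (((2 : ℕ) : ℤ) : ℝ) = 2; simp

/-- The remainder of `e` on division by `f`. -/
def Expr.rem (e f : Expr) : Expr := e - f * Expr.floor (e / f)

theorem Expr.eval_rem {σ : State} {e f : Expr} {x y : ℕ} (he : e.eval σ = x) (hf : f.eval σ = y) :
    (e.rem f).eval σ = ((x % y : ℕ) : ℝ) := by
  have h1 : (⌊(x : ℝ) / (y : ℝ)⌋ : ℤ) = ((x / y : ℕ) : ℤ) := by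
    rw [← Nat.floor_div_eq_div (K := ℝ), Int.natCast_floor_eq_floor (by positivity)]
  have h2 : (x : ℝ) = (y : ℝ) * ((x / y : ℕ) : ℝ) + ((x % y : ℕ) : ℝ) := by
    exact_mod_cast (Nat.div_add_mod x y).symm
  simp only [Expr.rem, Expr.eval_sub, Expr.eval_mul, Expr.eval_floor, Expr.eval_div, he, hf, h1,
    Int.cast_natCast]
  linarith

theorem Expr.eval_floor_div {σ : State} {e f : Expr} {x y : ℕ} (he : e.eval σ = x)
    (hf : f.eval σ = y) : (Expr.floor (e / f)).eval σ = ((x / y : ℕ) : ℝ) := by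
  have h1 : (⌊(x : ℝ) / (y : ℝ)⌋ : ℤ) = ((x / y : ℕ) : ℤ) := by
    rw [← Nat.floor_div_eq_div (K := ℝ), Int.natCast_floor_eq_floor (by positivity)]
  simp only [Expr.eval_floor, Expr.eval_div, he, hf, h1, Int.cast_natCast]

@[simp] theorem Test.holds_lt (σ : State) (e f : Expr) :
    (Test.lt e f).Holds σ ↔ e.eval σ < f.eval σ := Iff.rfl
@[simp] theorem Test.holds_le (σ : State) (e f : Expr) :
    (Test.le e f).Holds σ ↔ e.eval σ ≤ f.eval σ := Iff.rfl

/-- The registers to which a program may assign. -/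
def Program.writes : Program → List ℕ
  | .skip => []
  | .assign r _ => [r]
  | .store _ _ => []
  | .seq P Q => P.writes ++ Q.writes
  | .ite _ P Q => P.writes ++ Q.writes
  | .loop _ P => P.writes

/-- The program contains no `store`. -/
def Program.storeFree : Program → Bool
  | .skip => true
  | .assign _ _ => true
  | .store _ _ => false
  | .seq P Q => P.storeFree && Q.storeFree
  | .ite _ P Q => P.storeFree && Q.storeFree
  | .loop _ P => P.storeFree

/-- `τ` differs from `σ` only where the text of `P` allows `P` to write. -/
def Frame (P : Program) (σ τ : State) : Prop :=
  (∀ r, r ∉ P.writes → τ.reg r = σ.reg r) ∧ (P.storeFree = true → τ.mem = σ.mem)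

theorem Frame.refl (P : Program) (σ : State) : Frame P σ σ := ⟨fun _ _ => rfl, fun _ => rfl⟩

theorem Frame.trans {P : Program} {σ τ υ : State} (h : Frame P σ τ) (h' : Frame P τ υ) :
    Frame P σ υ :=
  ⟨fun r hr => (h'.1 r hr).trans (h.1 r hr), fun hs => (h'.2 hs).trans (h.2 hs)⟩

theorem Frame.reg {P : Program} {σ τ : State} (h : Frame P σ τ) (r : ℕ)
    (hr : r ∉ P.writes := by decide) : τ.reg r = σ.reg r := h.1 r hr

theorem Frame.mem {P : Program} {σ τ : State} (h : Frame P σ τ)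
    (hs : P.storeFree = true := by decide) : τ.mem = σ.mem := h.2 hs

/-- Facts about registers that a program does not write carry over without an invariant. -/
theorem Exec.frame {P : Program} {σ τ : State} {t : ℕ} (h : Exec P σ τ t) : Frame P σ τ := by
  induction h with
  | skip σ => exact Frame.refl _ _
  | assign σ r e =>
    refine ⟨fun r' hr' => ?_, fun _ => rfl⟩
    have : r' ≠ r := by simpa [Program.writes] using hr'
    simp [this]
  | store σ a v => exact ⟨fun _ _ => rfl, fun h => by simp [Program.storeFree] at h⟩
  | seq _ _ h1 h2 =>
    refine ⟨fun r hr => ?_, fun hs => ?_⟩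
    · simp only [Program.writes, List.mem_append, not_or] at hr
      rw [h2.1 r hr.2, h1.1 r hr.1]
    · simp only [Program.storeFree, Bool.and_eq_true] at hs
      rw [h2.2 hs.2, h1.2 hs.1]
  | ite_true _ _ h1 =>
    refine ⟨fun r hr => ?_, fun hs => ?_⟩
    · simp only [Program.writes, List.mem_append, not_or] at hr
      exact h1.1 r hr.1
    · simp only [Program.storeFree, Bool.and_eq_true] at hs
      exact h1.2 hs.1
  | ite_false _ _ h1 =>
    refine ⟨fun r hr => ?_, fun hs => ?_⟩
    · simp only [Program.writes, List.mem_append, not_or] at hr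
      exact h1.1 r hr.2
    · simp only [Program.storeFree, Bool.and_eq_true] at hs
      exact h1.2 hs.2
  | loop_true _ _ _ h1 h2 => exact Frame.trans (P := .loop _ _) h1 h2
  | loop_false _ => exact Frame.refl _ _

/-- Total correctness with a time bound: started in `σ`, the program `P` halts within time `T`
in a state that satisfies `Q`. -/
def Runs (P : Program) (σ : State) (T : ℕ) (Q : State → Prop) : Prop :=
  ∃ τ t, Exec P σ τ t ∧ t ≤ T ∧ Q τ

theorem Runs.mono {P : Program} {σ : State} {T T' : ℕ} {Q Q' : State → Prop}
    (h : Runs P σ T Q) (hT : T ≤ T') (hQ : ∀ τ, Frame P σ τ → Q τ → Q' τ) : Runs P σ T' Q' := by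
  obtain ⟨τ, t, hE, ht, hq⟩ := h
  exact ⟨τ, t, hE, ht.trans hT, hQ τ hE.frame hq⟩

theorem Runs.seq {P R : Program} {σ : State} {T₁ T₂ T : ℕ} {Q₁ Q : State → Prop}
    (h₁ : Runs P σ T₁ Q₁) (h₂ : ∀ τ, Frame P σ τ → Q₁ τ → Runs R τ T₂ Q) (hT : T₁ + T₂ ≤ T) :
    Runs (P ;; R) σ T Q := by
  obtain ⟨τ, t, hE, ht, hq⟩ := h₁
  obtain ⟨υ, u, hE', hu, hq'⟩ := h₂ τ hE.frame hq
  exact ⟨υ, t + u, hE.seq hE', by omega, hq'⟩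

/-- A loop that is executed exactly `N` times, with an invariant indexed by the number of
completed iterations. -/
theorem Runs.loop {b : Test} {P : Program} {σ : State} (N : ℕ) (inv : ℕ → State → Prop) {T : ℕ}
    {T' : ℕ} {Q : State → Prop}
    (h0 : inv 0 σ)
    (hstep : ∀ i < N, ∀ τ, Frame P σ τ → inv i τ → b.Holds τ ∧ Runs P τ T (inv (i + 1)))
    (hend : ∀ τ, Frame P σ τ → inv N τ → ¬ b.Holds τ ∧ Q τ)
    (hT : N * (T + 50) + 50 ≤ T') (hb : b.cost ≤ 50 := by decide) :
    Runs (.loop b P) σ T' Q := by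
  have key : ∀ m, ∀ i, i + m = N → ∀ τ, Frame P σ τ → inv i τ →
      ∃ υ t, Exec (.loop b P) τ υ t ∧ t ≤ m * (b.cost + T) + b.cost ∧ Q υ := by
    intro m
    induction m with
    | zero =>
      intro i hi τ hF hτ
      obtain rfl : i = N := by omega
      exact ⟨τ, b.cost, .loop_false (hend τ hF hτ).1, by simp, (hend τ hF hτ).2⟩
    | succ m ih =>
      intro i hi τ hF hτ
      obtain ⟨hb, υ, t, hE, ht, hυ⟩ := hstep i (by omega) τ hF hτ
      obtain ⟨ω, u, hE', hu, hω⟩ := ih (i + 1) (by omega) υ (hF.trans hE.frame) hυ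
      refine ⟨ω, b.cost + t + u, .loop_true hb hE hE', ?_, hω⟩
      rw [Nat.succ_mul]
      omega
  obtain ⟨υ, t, hE, ht, hQ⟩ := key N 0 (by simp) σ (Frame.refl _ _) h0
  refine ⟨υ, t, hE, ht.trans (le_trans ?_ hT), hQ⟩
  exact Nat.add_le_add (Nat.mul_le_mul_left _ (by omega)) hb

/-- The final state of a program without loops. -/
noncomputable def Program.run : Program → State → State
  | .skip, σ => σ
  | .assign r e, σ => ⟨Function.update σ.reg r (e.eval σ), σ.mem⟩
  | .store a v, σ => ⟨σ.reg, Function.update σ.mem ⌊a.eval σ⌋₊ (v.eval σ)⟩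
  | .seq P Q, σ => Q.run (P.run σ)
  | .ite b P Q, σ => open Classical in if b.Holds σ then P.run σ else Q.run σ
  | .loop _ _, σ => σ

/-- The program contains no loop. -/
def Program.loopFree : Program → Bool
  | .skip => true
  | .assign _ _ => true
  | .store _ _ => true
  | .seq P Q => P.loopFree && Q.loopFree
  | .ite _ P Q => P.loopFree && Q.loopFree
  | .loop _ _ => false

/-- A bound for the running time of a program without loops. -/
def Program.time : Program → ℕ
  | .skip => 1
  | .assign _ e => e.cost + 1
  | .store a v => a.cost + v.cost + 1
  | .seq P Q => P.time + Q.time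
  | .ite b P Q => b.cost + (P.time + Q.time)
  | .loop _ _ => 0

theorem Program.runs_of_loopFree (P : Program) (hP : P.loopFree = true) (σ : State) :
    Runs P σ P.time (fun τ => τ = P.run σ) := by
  induction P generalizing σ with
  | skip => exact ⟨_, _, .skip σ, le_rfl, rfl⟩
  | assign r e => exact ⟨_, _, .assign σ r e, le_rfl, rfl⟩
  | store a v => exact ⟨_, _, .store σ a v, le_rfl, rfl⟩
  | seq P Q h1 h2 =>
    simp only [Program.loopFree, Bool.and_eq_true] at hP
    exact (h1 hP.1 σ).seq (fun τ _ hτ => by subst hτ; exact h2 hP.2 _) le_rfl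
  | ite b P Q h1 h2 =>
    simp only [Program.loopFree, Bool.and_eq_true] at hP
    by_cases hb : b.Holds σ
    · obtain ⟨τ, t, hE, ht, rfl⟩ := h1 hP.1 σ
      exact ⟨_, _, .ite_true hb hE, by simp only [Program.time]; omega, by simp [Program.run, hb]⟩
    · obtain ⟨τ, t, hE, ht, rfl⟩ := h2 hP.2 σ
      exact ⟨_, _, .ite_false hb hE, by simp only [Program.time]; omega, by simp [Program.run, hb]⟩
  | loop => simp [Program.loopFree] at hP

/-- A program without loops is verified by computing its final state; the side conditions are
decided by evaluation. -/
theorem Runs.straight {P : Program} {σ : State} {T : ℕ} {Q : State → Prop} (h : Q (P.run σ))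
    (hT : P.time ≤ T := by decide) (hP : P.loopFree = true := by decide) : Runs P σ T Q :=
  (P.runs_of_loopFree hP σ).mono hT (fun τ _ hτ => by subst hτ; exact h)

end RealRAM

/-! ### Numbers packed from digits -/

/-- The natural number with `N` digits `a 0, …, a (N - 1)` in base `X` (least significant digit
first), that is the value at `X` of the polynomial with coefficients `a`. -/
def packed (a : ℕ → ℕ) (N X : ℕ) : ℕ := ∑ u ∈ Finset.range N, a u * X ^ u

theorem packed_succ (a : ℕ → ℕ) (N X : ℕ) :
    packed a (N + 1) X = packed a N X + a N * X ^ N := Finset.sum_range_succ _ _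

theorem packed_lt {a : ℕ → ℕ} {N X : ℕ} (h : ∀ u < N, a u < X) : packed a N X < X ^ N := by
  induction N with
  | zero => simp [packed]
  | succ N ih =>
    rw [packed_succ]
    have h1 := ih (fun u hu => h u (by omega))
    have h2 : (a N + 1) * X ^ N ≤ X * X ^ N := Nat.mul_le_mul_right _ (h N (by omega))
    rw [pow_succ]
    linarith

theorem packed_add (a : ℕ → ℕ) (k l X : ℕ) :
    packed a (k + l) X = packed a k X + X ^ k * packed (fun t => a (k + t)) l X := by
  unfold packed
  rw [Finset.sum_range_add, Finset.mul_sum]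
  congr 1
  refine Finset.sum_congr rfl fun t _ => ?_
  rw [pow_add]; ring

/-- A division and a remainder cut out the digits from `k` to `k + l - 1`. -/
theorem packed_slice {a : ℕ → ℕ} {N X : ℕ} (h : ∀ u < N, a u < X) {k l : ℕ} (hkl : k + l ≤ N) :
    packed a N X / X ^ k % X ^ l = packed (fun t => a (k + t)) l X := by
  obtain ⟨m, rfl⟩ := Nat.exists_eq_add_of_le hkl
  by_cases hN : k + l + m = 0
  · obtain ⟨rfl, rfl, rfl⟩ : k = 0 ∧ l = 0 ∧ m = 0 := by omega
    simp [packed, Nat.mod_one]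
  have hX : 0 < X := lt_of_le_of_lt (Nat.zero_le _) (h 0 (by omega))
  rw [add_assoc, packed_add, Nat.add_mul_div_left _ _ (pow_pos hX k),
    Nat.div_eq_of_lt (packed_lt fun u hu => h u (by omega)), zero_add, packed_add,
    Nat.add_mul_mod_self_left, Nat.mod_eq_of_lt (packed_lt fun u hu => h _ (by omega))]

/-- Casting out `X - 1` computes the digit sum. -/
theorem packed_mod_pred {a : ℕ → ℕ} {N X : ℕ} (hX : ∑ u ∈ Finset.range N, a u < X - 1) :
    packed a N X % (X - 1) = ∑ u ∈ Finset.range N, a u := by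
  have h : packed a N X ≡ ∑ u ∈ Finset.range N, a u [MOD X - 1] := by
    unfold packed
    have hX1 : X ≡ 1 [MOD X - 1] := by
      have : X = (X - 1) + 1 := by omega
      conv_lhs => rw [this]
      simp [Nat.ModEq]
    refine Nat.ModEq.sum fun u _ => ?_
    simpa using (hX1.pow u).mul_left (a u)
  exact (Nat.mod_eq_of_lt hX) ▸ h

/-- Reducing the base: modulo `Z - Y` the base `Z` may be replaced by `Y`. -/
theorem packed_mod_sub {a : ℕ → ℕ} {N Y Z : ℕ} (hYZ : Y ≤ Z) (h : packed a N Y < Z - Y) :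
    packed a N Z % (Z - Y) = packed a N Y := by
  have hZ : Z ≡ Y [MOD Z - Y] := by
    have : Z = (Z - Y) + Y := by omega
    conv_lhs => rw [this]
    simp [Nat.ModEq]
  have : packed a N Z ≡ packed a N Y [MOD Z - Y] :=
    Nat.ModEq.sum fun u _ => (hZ.pow u).mul_left (a u)
  exact (Nat.mod_eq_of_lt h) ▸ this

theorem packed_le {a : ℕ → ℕ} {B X m : ℕ} (hX : 0 < X) (h : ∀ u < B, a u ≤ m) :
    packed a B X ≤ B * m * X ^ (B - 1) := by
  unfold packed
  calc ∑ u ∈ Finset.range B, a u * X ^ u ≤ ∑ u ∈ Finset.range B, m * X ^ (B - 1) := by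
        refine Finset.sum_le_sum fun u hu => ?_
        rw [Finset.mem_range] at hu
        exact Nat.mul_le_mul (h u hu) (Nat.pow_le_pow_right hX (by omega))
    _ = B * m * X ^ (B - 1) := by simp [mul_assoc]

/-- All digits of a number can be squared in a constant number of operations.  Let `Z = Y ^ B`.
The product of the packings in base `Z` and `Z ^ B` has the coefficient `a u * a v` at the
exponent `u + B * v`, which is divisible by `B + 1` exactly for `u = v`.  Modulo
`Z ^ (B + 1) - Y` one may replace `Z ^ (B + 1)` by `Y`, so that reduction modulo `Z` then leaves
the terms with `u = v`, packed in base `Y`. -/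
theorem packed_square {a : ℕ → ℕ} {B Y m : ℕ} (hB : 2 ≤ B) (hm : 1 ≤ m) (h : ∀ u < B, a u ≤ m)
    (hY : 2 * B ^ 2 * m ^ 2 ≤ Y) :
    ((packed a B ((Y ^ B) ^ B) % ((Y ^ B) ^ B - Y ^ B)) * packed a B ((Y ^ B) ^ B)) %
      ((Y ^ B) ^ B * Y ^ B - Y) % Y ^ B = packed (fun u => a u ^ 2) B Y := by
  have hmod : ∀ u v, u < B → v < B → (u + B * v) % (B + 1) = 0 → v = u := by
    intro u v hu hv h0
    obtain ⟨q, hq⟩ := Nat.dvd_of_mod_eq_zero h0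
    have hqB : q < B := by
      by_contra hle
      have h1 : (B + 1) * B ≤ (B + 1) * q := Nat.mul_le_mul_left _ (by omega)
      have h2 : B * (v + 1) ≤ B * B := Nat.mul_le_mul_left _ hv
      nlinarith
    have h1 : u = q := by
      have : (u + B * v) % B = (q + B * q) % B := by rw [hq]; ring_nf
      rwa [Nat.add_mul_mod_self_left, Nat.add_mul_mod_self_left, Nat.mod_eq_of_lt hu,
        Nat.mod_eq_of_lt hqB] at this
    subst h1
    have : B * v = B * u := by linarith
    exact Nat.eq_of_mul_eq_mul_left (by omega) this
  have hBm : 4 * (B * m) ≤ Y := by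
    have h1 : 2 * 1 ≤ B * m := Nat.mul_le_mul hB hm
    nlinarith
  have hBm' : 2 ≤ B * m := Nat.mul_le_mul hB hm
  have hY0 : 0 < Y := by omega
  set Z := Y ^ B with hZdef
  have hYZ : Y ≤ Z := Nat.le_self_pow (by omega) Y
  have hZ2 : Z * Z ≤ Z ^ B := by
    rw [← sq]; exact Nat.pow_le_pow_right (by omega) hB
  have h8 : 8 * Z ≤ Z ^ B := le_trans (Nat.mul_le_mul_right _ (by omega)) hZ2
  -- the first reduction passes from base `Z ^ B` to base `Z`
  have hfirst : packed a B (Z ^ B) % (Z ^ B - Z) = packed a B Z := by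
    refine packed_mod_sub (by omega) ?_
    have h1 := packed_le (by omega : 0 < Z) h
    have h2 : 4 * (B * m * Z ^ (B - 1)) ≤ Z ^ B := by
      calc 4 * (B * m * Z ^ (B - 1)) = 4 * (B * m) * Z ^ (B - 1) := by ring
        _ ≤ Z * Z ^ (B - 1) := Nat.mul_le_mul_right _ (by omega)
        _ = Z ^ B := by rw [mul_comm, pow_sub_one_mul (by omega)]
    omega
  rw [hfirst]
  have hprod : packed a B Z * packed a B (Z ^ B) =
      ∑ u ∈ Finset.range B, ∑ v ∈ Finset.range B, a u * a v * Z ^ (u + B * v) := by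
    unfold packed
    rw [Finset.sum_mul_sum]
    refine Finset.sum_congr rfl fun u _ => Finset.sum_congr rfl fun v _ => ?_
    rw [pow_add, pow_mul]; ring
  set S := ∑ u ∈ Finset.range B, ∑ v ∈ Finset.range B,
    a u * a v * (Z ^ ((u + B * v) % (B + 1)) * Y ^ ((u + B * v) / (B + 1))) with hS
  have hZB : Y ≤ Z ^ B * Z := hYZ.trans (Nat.le_mul_of_pos_left _ (by omega))
  have hcong : packed a B Z * packed a B (Z ^ B) ≡ S [MOD Z ^ B * Z - Y] := by
    rw [hprod]
    have hZ : Z ^ (B + 1) ≡ Y [MOD Z ^ B * Z - Y] := by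
      have h1 : Z ^ (B + 1) = (Z ^ B * Z - Y) + Y := by rw [pow_succ]; omega
      conv_lhs => rw [h1]
      simp [Nat.ModEq]
    refine Nat.ModEq.sum fun u _ => Nat.ModEq.sum fun v _ => Nat.ModEq.mul_left _ ?_
    conv_lhs => rw [← Nat.mod_add_div (u + B * v) (B + 1), pow_add, pow_mul]
    exact (hZ.pow _).mul_left _
  have hSlt : S < Z ^ B * Z - Y := by
    have h1 : S ≤ B ^ 2 * m ^ 2 * (Z ^ B * Y ^ (B - 1)) := by
      calc S ≤ ∑ u ∈ Finset.range B, ∑ v ∈ Finset.range B, m * m * (Z ^ B * Y ^ (B - 1)) := by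
            refine Finset.sum_le_sum fun u hu => Finset.sum_le_sum fun v hv => ?_
            rw [Finset.mem_range] at hu hv
            refine Nat.mul_le_mul (Nat.mul_le_mul (h u hu) (h v hv)) (Nat.mul_le_mul
              (Nat.pow_le_pow_right (by omega) (by
                have := Nat.mod_lt (u + B * v) (by omega : B + 1 > 0); omega))
              (Nat.pow_le_pow_right hY0 ?_))
            have h3 : (u + B * v) / (B + 1) < B := by
              rw [Nat.div_lt_iff_lt_mul (by omega)]
              have : B * (v + 1) ≤ B * B := Nat.mul_le_mul_left _ hv
              nlinarith
            omega
        _ = B ^ 2 * m ^ 2 * (Z ^ B * Y ^ (B - 1)) := by simp; ring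
    have h2 : 2 * S ≤ Z ^ B * Z := by
      calc 2 * S ≤ (2 * B ^ 2 * m ^ 2) * (Z ^ B * Y ^ (B - 1)) := by linarith
        _ ≤ Y * (Z ^ B * Y ^ (B - 1)) := Nat.mul_le_mul_right _ hY
        _ = Z ^ B * (Y ^ (B - 1) * Y) := by ring
        _ = Z ^ B * Z := by rw [pow_sub_one_mul (by omega)]
    have h3 : 8 * Z * 1 ≤ Z ^ B * Z := Nat.mul_le_mul h8 (by omega)
    omega
  rw [show (packed a B Z * packed a B (Z ^ B)) % (Z ^ B * Z - Y) = S from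
    (Nat.mod_eq_of_lt hSlt) ▸ hcong]
  have hlt : packed (fun u => a u ^ 2) B Y < Z := by
    refine packed_lt fun u hu => ?_
    have h1 : a u ^ 2 ≤ m ^ 2 := Nat.pow_le_pow_left (h u hu) 2
    have h2 : 1 * 1 ≤ B ^ 2 * m ^ 2 :=
      Nat.mul_le_mul (Nat.one_le_pow _ _ (by omega)) (Nat.one_le_pow _ _ hm)
    have h4 : 4 * m ^ 2 ≤ B ^ 2 * m ^ 2 := Nat.mul_le_mul_right _ (by nlinarith)
    nlinarith
  have hfin : S ≡ packed (fun u => a u ^ 2) B Y [MOD Z] := by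
    unfold packed
    refine Nat.ModEq.sum fun u hu => ?_
    have h1 : a u ^ 2 * Y ^ u = ∑ v ∈ Finset.range B, if v = u then a u ^ 2 * Y ^ u else 0 := by
      rw [Finset.sum_ite_eq' (Finset.range B) u]; simp [hu]
    rw [h1]
    refine Nat.ModEq.sum fun v hv => ?_
    rw [Finset.mem_range] at hu hv
    split_ifs with hvu
    · subst hvu
      have h2 : v + B * v = (B + 1) * v := by ring
      rw [h2, Nat.mul_mod_right, Nat.mul_div_cancel_left _ (by omega)]
      simp [sq, Nat.ModEq]
    · have h2 : (u + B * v) % (B + 1) ≠ 0 := fun h0 => hvu (hmod u v hu hv h0)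
      refine (Nat.modEq_zero_iff_dvd).2 (Dvd.dvd.mul_left (Dvd.dvd.mul_right
        (dvd_pow_self Z h2) _) _)
  exact (Nat.mod_eq_of_lt hlt) ▸ hfin

theorem sum_range_mul_eq {R : Type*} [AddCommMonoid R] (f : ℕ → R) (p q : ℕ) :
    ∑ u ∈ Finset.range (p * q), f u =
      ∑ v ∈ Finset.range q, ∑ t ∈ Finset.range p, f (t + p * v) := by
  induction q with
  | zero => simp
  | succ q ih =>
    rw [Nat.mul_succ, Finset.sum_range_add, ih, Finset.sum_range_succ]
    simp only [add_comm]

theorem digit_add_mul {H D t v i : ℕ} (hi : i < D) :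
    (t + H ^ D * v) / H ^ i % H = t / H ^ i % H := by
  rcases Nat.eq_zero_or_pos H with rfl | hH
  · simp [show D ≠ 0 by omega]
  obtain ⟨k, rfl⟩ : ∃ k, D = i + 1 + k := Nat.exists_eq_add_of_le hi
  have : t + H ^ (i + 1 + k) * v = t + H ^ i * (H * (H ^ k * v)) := by ring
  rw [this, Nat.add_mul_div_left _ _ (pow_pos hH i), Nat.add_mul_mod_self_left]

/-- If a weight of `u` is the product of weights of the digits of `u` in base `H`, then its
generating function is a product as well. -/
theorem sum_prod_digit {R : Type*} [CommSemiring R] (H : ℕ) (φ : ℕ → ℕ → R) (X : R) (D : ℕ) :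
    ∑ u ∈ Finset.range (H ^ D), (∏ i ∈ Finset.range D, φ i (u / H ^ i % H)) * X ^ u =
      ∏ i ∈ Finset.range D, ∑ v ∈ Finset.range H, φ i v * (X ^ H ^ i) ^ v := by
  induction D with
  | zero => simp
  | succ D ih =>
    rw [Finset.prod_range_succ, ← ih, Finset.sum_mul_sum, pow_succ, Finset.sum_comm,
      sum_range_mul_eq]
    refine Finset.sum_congr rfl fun v hv => Finset.sum_congr rfl fun t ht => ?_
    rw [Finset.mem_range] at hv ht
    rw [Finset.prod_range_succ, Finset.prod_congr rfl fun i hi => by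
      rw [digit_add_mul (Finset.mem_range.1 hi)]]
    rw [Nat.add_mul_div_left _ _ (by omega), Nat.div_eq_of_lt ht, zero_add, Nat.mod_eq_of_lt hv,
      pow_add, pow_mul]
    ring

theorem exists_digits (H : ℕ) (w : ℕ → ℕ) (D : ℕ) (hw : ∀ i < D, w i < H) :
    ∃ u < H ^ D, ∀ i < D, u / H ^ i % H = w i := by
  induction D with
  | zero => exact ⟨0, by simp, by simp⟩
  | succ D ih =>
    obtain ⟨u, hu, h⟩ := ih fun i hi => hw i (by omega)
    have hwD := hw D (by omega)
    refine ⟨u + H ^ D * w D, ?_, fun i hi => ?_⟩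
    · calc u + H ^ D * w D < H ^ D * (w D + 1) := by linarith
        _ ≤ H ^ D * H := Nat.mul_le_mul_left _ hwD
        _ = H ^ (D + 1) := (pow_succ _ _).symm
    · rcases Nat.lt_succ_iff_lt_or_eq.1 hi with h1 | rfl
      · rw [digit_add_mul h1, h i h1]
      · rw [Nat.add_mul_div_left _ _ (by omega), Nat.div_eq_of_lt hu, zero_add,
          Nat.mod_eq_of_lt hwD]

/-! ### Generating functions of sets of cubes -/

/-- A cube of `s ^ d` grid cells is encoded by the number `u < H ^ (d + 1)` with digits
`w 0, …, w (d - 1), s` in base `H`, where `w` is the topmost cell.  `InBox G H d lo hi u` says that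
`1 ≤ s ≤ G` and `lo s i ≤ w i < hi s i` for all `i`. -/
def InBox (G H d : ℕ) (lo hi : ℕ → ℕ → ℕ) (u : ℕ) : Prop :=
  (1 ≤ u / H ^ d ∧ u / H ^ d ≤ G) ∧
    ∀ i < d, lo (u / H ^ d) i ≤ u / H ^ i % H ∧ u / H ^ i % H < hi (u / H ^ d) i

open Classical in
/-- The indicator function of `InBox`. -/
noncomputable def boxInd (G H d : ℕ) (lo hi : ℕ → ℕ → ℕ) (u : ℕ) : ℕ :=
  if InBox G H d lo hi u then 1 else 0

theorem sum_indicator_Ico {lo hi H : ℕ} (h1 : lo ≤ hi) (h2 : hi ≤ H) {Z : ℝ} (hZ : Z ≠ 1) :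
    ∑ v ∈ Finset.range H, (if lo ≤ v ∧ v < hi then (1 : ℝ) else 0) * Z ^ v =
      Z ^ lo * ((Z ^ (hi - lo) - 1) / (Z - 1)) := by
  have h3 : Finset.filter (fun v => lo ≤ v ∧ v < hi) (Finset.range H) = Finset.Ico lo hi := by
    ext v; simp; omega
  simp only [ite_mul, one_mul, zero_mul]
  rw [← Finset.sum_filter, h3, geom_sum_Ico hZ h1, mul_div_assoc', mul_sub, ← pow_add,
    Nat.add_sub_cancel' h1, mul_one]

/-- The generating function of a box is a sum of products of geometric sums. -/
theorem sum_boxInd {G H d : ℕ} {lo hi : ℕ → ℕ → ℕ} (hG : G < H)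
    (hlo : ∀ k < G, ∀ i < d, lo (k + 1) i ≤ hi (k + 1) i)
    (hhi : ∀ k < G, ∀ i < d, hi (k + 1) i ≤ H) {X : ℝ} (hX : 1 < X) :
    ∑ u ∈ Finset.range (H ^ (d + 1)), (boxInd G H d lo hi u : ℝ) * X ^ u =
      ∑ k ∈ Finset.range G, (∏ i ∈ Finset.range d, (X ^ H ^ i) ^ lo (k + 1) i *
        (((X ^ H ^ i) ^ (hi (k + 1) i - lo (k + 1) i) - 1) / (X ^ H ^ i - 1))) *
          (X ^ H ^ d) ^ (k + 1) := by
  classical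
  let φ : ℕ → ℕ → ℕ → ℝ := fun k i v =>
    if i < d then (if lo (k + 1) i ≤ v ∧ v < hi (k + 1) i then 1 else 0)
    else (if v = k + 1 then 1 else 0)
  have hind : ∀ u ∈ Finset.range (H ^ (d + 1)), (boxInd G H d lo hi u : ℝ) * X ^ u =
      ∑ k ∈ Finset.range G, (∏ i ∈ Finset.range (d + 1), φ k i (u / H ^ i % H)) * X ^ u := by
    intro u hu
    rw [Finset.mem_range] at hu
    rw [← Finset.sum_mul]
    congr 1
    have hdig : u / H ^ d % H = u / H ^ d := Nat.mod_eq_of_lt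
      (by rw [Nat.div_lt_iff_lt_mul (by apply pow_pos; omega)]; rwa [pow_succ, mul_comm] at hu)
    have hprod : ∀ k, ∏ i ∈ Finset.range (d + 1), φ k i (u / H ^ i % H) =
        if u / H ^ d = k + 1 then (∏ i ∈ Finset.range d,
          if lo (u / H ^ d) i ≤ u / H ^ i % H ∧ u / H ^ i % H < hi (u / H ^ d) i then (1 : ℝ)
            else 0) else 0 := by
      intro k
      rw [Finset.prod_range_succ]
      simp only [φ, lt_irrefl, if_false, hdig]
      split_ifs with h
      · rw [mul_one, ← h]
        exact Finset.prod_congr rfl fun i hi => by rw [if_pos (Finset.mem_range.1 hi)]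
      · simp
    simp only [hprod]
    by_cases hs : 1 ≤ u / H ^ d ∧ u / H ^ d ≤ G
    · rw [Finset.sum_eq_single (u / H ^ d - 1)]
      · rw [if_pos (by omega), boxInd, InBox]
        by_cases hw : ∀ i < d, lo (u / H ^ d) i ≤ u / H ^ i % H ∧ u / H ^ i % H < hi (u / H ^ d) i
        · rw [if_pos ⟨hs, hw⟩, Finset.prod_congr rfl fun i hi => if_pos (hw i
            (Finset.mem_range.1 hi))]
          simp
        · rw [if_neg fun h => hw h.2]
          push Not at hw
          obtain ⟨i, hi, h⟩ := hw
          rw [Finset.prod_eq_zero (Finset.mem_range.2 hi)]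
          · simp
          · rw [if_neg]; intro h'; exact absurd (h h'.1) (by omega)
      · intro k _ hk
        exact if_neg (by omega)
      · intro h; rw [Finset.mem_range] at h; omega
    · rw [boxInd, if_neg fun h => hs h.1, Finset.sum_eq_zero]
      · simp
      · intro k hk
        rw [Finset.mem_range] at hk
        exact if_neg fun h => hs (by omega)
  rw [Finset.sum_congr rfl hind, Finset.sum_comm]
  refine Finset.sum_congr rfl fun k hk => ?_
  rw [Finset.mem_range] at hk
  rw [sum_prod_digit, Finset.prod_range_succ]
  congr 1
  · refine Finset.prod_congr rfl fun i hi' => ?_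
    rw [Finset.mem_range] at hi'
    simp only [φ, hi', if_true]
    refine sum_indicator_Ico (hlo k hk i hi') (hhi k hk i hi') ?_
    exact (one_lt_pow₀ hX (pow_ne_zero _ (by omega))).ne'
  · simp only [φ, lt_irrefl, if_false, ite_mul, one_mul, zero_mul]
    rw [Finset.sum_ite_eq', if_pos]
    rw [Finset.mem_range]; omega

/-- The weight of the cube of cells encoded by `u`, for `n` points in the cells `c j`: it is at
most `2 * n`, with equality if and only if the cube lies in the grid and contains no point. -/
noncomputable def weight (n d G H : ℕ) (c : ℕ → ℕ → ℕ) (u : ℕ) : ℕ :=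
  n * boxInd G H d (fun s _ => s - 1) (fun _ _ => G) u +
    (n - ∑ j ∈ Finset.range n, boxInd G H d (fun _ i => c j i) (fun s i => c j i + s) u)

/-- `u` encodes a cube of cells in the grid that contains none of the points. -/
def Full (n d G H : ℕ) (c : ℕ → ℕ → ℕ) (u : ℕ) : Prop :=
  InBox G H d (fun s _ => s - 1) (fun _ _ => G) u ∧
    ∀ j < n, ¬ InBox G H d (fun _ i => c j i) (fun s i => c j i + s) u

theorem boxInd_le (G H d : ℕ) (lo hi : ℕ → ℕ → ℕ) (u : ℕ) : boxInd G H d lo hi u ≤ 1 := by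
  unfold boxInd; split_ifs <;> simp

theorem sum_boxInd_le (n d G H : ℕ) (c : ℕ → ℕ → ℕ) (u : ℕ) :
    ∑ j ∈ Finset.range n, boxInd G H d (fun _ i => c j i) (fun s i => c j i + s) u ≤ n := by
  calc _ ≤ ∑ j ∈ Finset.range n, 1 := Finset.sum_le_sum fun j _ => boxInd_le _ _ _ _ _ _
    _ = n := by simp

theorem weight_le (n d G H : ℕ) (c : ℕ → ℕ → ℕ) (u : ℕ) : weight n d G H c u ≤ 2 * n := by
  have h1 := boxInd_le G H d (fun s _ => s - 1) (fun _ _ => G) u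
  have h2 : n * boxInd G H d (fun s _ => s - 1) (fun _ _ => G) u ≤ n * 1 :=
    Nat.mul_le_mul_left _ h1
  unfold weight
  omega

theorem weight_eq_iff {n d G H : ℕ} (hn : 1 ≤ n) (c : ℕ → ℕ → ℕ) (u : ℕ) :
    weight n d G H c u = 2 * n ↔ Full n d G H c u := by
  classical
  have h3 := sum_boxInd_le n d G H c u
  have h4 : ∑ j ∈ Finset.range n, boxInd G H d (fun _ i => c j i) (fun s i => c j i + s) u = 0 ↔
      ∀ j < n, ¬ InBox G H d (fun _ i => c j i) (fun s i => c j i + s) u := by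
    simp [boxInd]
  unfold weight Full
  rw [← h4]
  by_cases hb : InBox G H d (fun s _ => s - 1) (fun _ _ => G) u
  · simp only [boxInd, hb, if_true, true_and, mul_one] at h3 ⊢
    omega
  · simp only [boxInd, hb, if_false, false_and, iff_false, mul_zero]
    omega

/-- The generating function of the weights in a form that takes few arithmetic operations. -/
theorem packed_weight {n d G H : ℕ} {c : ℕ → ℕ → ℕ} (hH : H = 2 * G) (hG : 1 ≤ G)
    (hc : ∀ j < n, ∀ i < d, c j i ≤ G) {X : ℕ} (hX : 1 < X) :
    (packed (weight n d G H c) (H ^ (d + 1)) X : ℝ) =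
      n * (∑ k ∈ Finset.range G, (∏ i ∈ Finset.range d, (((X : ℝ) ^ H ^ i) ^ k *
        ((((X : ℝ) ^ H ^ i) ^ (G - k) - 1) / ((X : ℝ) ^ H ^ i - 1)))) *
          ((X : ℝ) ^ H ^ d) ^ (k + 1)) +
      n * (((X : ℝ) ^ H ^ (d + 1) - 1) / ((X : ℝ) - 1)) -
      (∑ j ∈ Finset.range n, ∏ i ∈ Finset.range d, ((X : ℝ) ^ H ^ i) ^ c j i) *
        ∑ k ∈ Finset.range G, (∏ i ∈ Finset.range d,
          ((((X : ℝ) ^ H ^ i) ^ (k + 1) - 1) / ((X : ℝ) ^ H ^ i - 1))) *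
            ((X : ℝ) ^ H ^ d) ^ (k + 1) := by
  have hX' : (1 : ℝ) < X := by exact_mod_cast hX
  have hcast : ∀ u, (weight n d G H c u : ℝ) =
      n * (boxInd G H d (fun s _ => s - 1) (fun _ _ => G) u : ℝ) + n -
        ∑ j ∈ Finset.range n,
          (boxInd G H d (fun _ i => c j i) (fun s i => c j i + s) u : ℝ) := by
    intro u
    unfold weight
    rw [Nat.cast_add, Nat.cast_sub (sum_boxInd_le n d G H c u)]
    push_cast; ring
  have hval := sum_boxInd (G := G) (H := H) (d := d) (lo := fun s _ => s - 1)
    (hi := fun _ _ => G) (by omega) (fun k hk _ _ => by omega) (fun _ _ _ _ => by omega) hX'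
  have hpt : ∀ j ∈ Finset.range n, _ := fun j hj => sum_boxInd (G := G) (H := H) (d := d)
    (lo := fun _ i => c j i) (hi := fun s i => c j i + s) (by omega) (fun k _ _ _ => by omega)
    (fun k hk i hi => by have := hc j (Finset.mem_range.1 hj) i hi; omega) hX'
  simp only [Nat.add_sub_cancel, Nat.add_sub_cancel_left] at hval hpt
  have hsplit : ∀ u, (weight n d G H c u : ℝ) * (X : ℝ) ^ u =
      n * ((boxInd G H d (fun s _ => s - 1) (fun _ _ => G) u : ℝ) * (X : ℝ) ^ u) +
        n * (X : ℝ) ^ u - ∑ j ∈ Finset.range n,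
          (boxInd G H d (fun _ i => c j i) (fun s i => c j i + s) u : ℝ) * (X : ℝ) ^ u := by
    intro u; rw [hcast, ← Finset.sum_mul]; ring
  unfold packed
  push_cast
  simp only [hsplit, Finset.sum_add_distrib, Finset.sum_sub_distrib, ← Finset.mul_sum]
  rw [hval, geom_sum_eq hX'.ne', Finset.sum_comm, Finset.sum_congr rfl hpt, Finset.sum_mul_sum]
  congr 1
  refine Finset.sum_congr rfl fun j _ => Finset.sum_congr rfl fun k _ => ?_
  rw [Finset.prod_mul_distrib, mul_assoc]

/-! ### Empty hypercubes and cubes of grid cells -/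

section Geometry

variable {d n : ℕ} {a : Fin d → ℝ} {L : ℝ} {x : Fin n → Fin d → ℝ}

theorem volume_openCube (c : Fin d → ℝ) {s : ℝ} (hs : 0 ≤ s) :
    MeasureTheory.volume (openCube c s) = ENNReal.ofReal (s ^ d) := by
  have : openCube c s = Set.univ.pi fun i => Set.Ioo (c i) (c i + s) := by
    ext p; simp [openCube]
  rw [this, Real.volume_pi_Ioo, ENNReal.ofReal_pow hs]
  simp

theorem bounds_of_openCube_subset {c : Fin d → ℝ} {s : ℝ} (hs : 0 < s)
    (h : openCube c s ⊆ closedCube a L) (i : Fin d) : a i ≤ c i ∧ c i + s ≤ a i + L := by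
  have key : ∀ δ, 0 < δ → δ < s → a i ≤ c i + δ ∧ c i + δ ≤ a i + L := by
    intro δ h1 h2
    exact h (show (fun i => c i + δ) ∈ openCube c s from fun i => by constructor <;> linarith) i
  constructor
  · by_contra hlt
    push Not at hlt
    have := (key (min (s / 2) ((a i - c i) / 2)) (lt_min (by linarith) (by linarith))
      (lt_of_le_of_lt (min_le_left _ _) (by linarith))).1
    have := min_le_right (s / 2) ((a i - c i) / 2)
    linarith
  · by_contra hlt
    push Not at hlt
    have h1 := (key (max (s / 2) (s - (c i + s - (a i + L)) / 2))
      (lt_of_lt_of_le (by linarith) (le_max_left _ _)) (max_lt (by linarith) (by linarith))).2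
    have := le_max_right (s / 2) (s - (c i + s - (a i + L)) / 2)
    linarith

/-- Among the `n + 1` equal cubes along the diagonal of `R` one is empty. -/
theorem exists_empty_diagonal_cube (hd : 1 ≤ d) (hL : 0 < L) :
    ∃ c, IsEmptyHypercube a L x c (L / (n + 1)) := by
  by_contra hne
  push Not at hne
  have hpos : 0 < L / ((n : ℝ) + 1) := by positivity
  have hmem : ∀ k : Fin (n + 1), ∃ j, x j ∈ openCube (fun i => a i + k * (L / (n + 1)))
      (L / (n + 1)) := by
    intro k
    by_contra hk
    push Not at hk
    refine hne _ ⟨hpos, fun p hp i => ?_, hk⟩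
    have h1 := hp i
    have h2 : ((k : ℕ) : ℝ) + 1 ≤ n + 1 := by exact_mod_cast k.2
    have h3 : (((k : ℕ) : ℝ) + 1) * (L / (n + 1)) ≤ (n + 1) * (L / (n + 1)) :=
      mul_le_mul_of_nonneg_right h2 hpos.le
    have h4 : ((n : ℝ) + 1) * (L / (n + 1)) = L := by field_simp
    have h5 : 0 ≤ ((k : ℕ) : ℝ) * (L / (n + 1)) := by positivity
    constructor <;> linarith [h1.1, h1.2]
  choose f hf using hmem
  have hlt : ∀ k k' : Fin (n + 1), k < k' → f k ≠ f k' := by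
    intro k k' hkk hff
    have h1 := (hf k ⟨0, hd⟩).2
    have h2 := (hf k' ⟨0, hd⟩).1
    rw [← hff] at h2
    have h3 : ((k : ℕ) : ℝ) + 1 ≤ (k' : ℕ) := by exact_mod_cast hkk
    have h4 := mul_le_mul_of_nonneg_right h3 hpos.le
    linarith
  have hinj : Function.Injective f := by
    intro k k' h
    rcases lt_trichotomy k k' with h1 | h1 | h1
    · exact absurd h (hlt _ _ h1)
    · exact h1
    · exact absurd h.symm (hlt _ _ h1)
  have := Fintype.card_le_of_injective f hinj
  simp at this

variable {G H : ℕ} {c : ℕ → ℕ → ℕ}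

/-- A full position encodes an empty hypercube.  Cells are half-open, so that a point in the open
cube lies in one of the cells of the cube. -/
theorem isEmptyHypercube_of_full (hL : 0 < L) (hG : 1 ≤ G)
    (hx : ∀ j, x j ∈ closedCube a L)
    (hc : ∀ (j : Fin n) (i : Fin d), c j i = ⌊(x j i - a i) * G / L⌋₊) {u : ℕ}
    (hu : Full n d G H c u) :
    IsEmptyHypercube a L x
      (fun i => a i + (((u / H ^ (i : ℕ) % H : ℕ) : ℝ) - (((u / H ^ d : ℕ) : ℝ) - 1)) * L / G)
      (((u / H ^ d : ℕ) : ℝ) * L / G) := by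
  have hG0 : (0 : ℝ) < G := by exact_mod_cast hG
  obtain ⟨⟨⟨hs1, hsG⟩, hw⟩, hj⟩ := hu
  set s := u / H ^ d
  have hs0 : (1 : ℝ) ≤ s := by exact_mod_cast hs1
  refine ⟨by positivity, fun p hp i => ?_, fun j hmem => hj j j.2 ⟨⟨hs1, hsG⟩, fun i hi => ?_⟩⟩
  · obtain ⟨h1, h2⟩ := hp i
    obtain ⟨h3, h4⟩ := hw i i.2
    dsimp only at h3 h4
    set w := u / H ^ (i : ℕ) % H
    have h5 : (s : ℝ) ≤ w + 1 := by exact_mod_cast (by omega : s ≤ w + 1)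
    have h6 : (w : ℝ) + 1 ≤ G := by exact_mod_cast h4
    have h7 : 0 ≤ ((w : ℝ) - (s - 1)) * L / G :=
      div_nonneg (mul_nonneg (by linarith) hL.le) hG0.le
    have h8 : ((w : ℝ) - (s - 1)) * L / G + s * L / G = (w + 1) * L / G := by ring
    have h9 : ((w : ℝ) + 1) * L / G ≤ L := by
      rw [div_le_iff₀ hG0]; nlinarith
    constructor
    · linarith
    · dsimp only at h2; linarith
  · obtain ⟨h1, h2⟩ := hmem ⟨i, hi⟩
    have hxi := hx j ⟨i, hi⟩
    have hci := hc j ⟨i, hi⟩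
    simp only at hci h1 h2
    dsimp only
    rw [hci]
    set w := u / H ^ i % H
    set y := (x j ⟨i, hi⟩ - a ⟨i, hi⟩) * G / L with hy
    have hy0 : 0 ≤ y := div_nonneg (mul_nonneg (by linarith [hxi.1]) hG0.le) hL.le
    have hxy : x j ⟨i, hi⟩ = a ⟨i, hi⟩ + y * L / G := by rw [hy]; field_simp; ring
    rw [hxy] at h1 h2
    have h3 : (w : ℝ) - (s - 1) < y := by
      have : ((w : ℝ) - (s - 1)) * L / G < y * L / G := by linarith
      rw [div_lt_div_iff_of_pos_right hG0] at this
      exact lt_of_mul_lt_mul_right this hL.le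
    have h4 : y < w + 1 := by
      have : y * L / G < ((w : ℝ) - (s - 1)) * L / G + s * L / G := by linarith
      have h8 : ((w : ℝ) - (s - 1)) * L / G + s * L / G = (w + 1) * L / G := by ring
      rw [h8, div_lt_div_iff_of_pos_right hG0] at this
      exact lt_of_mul_lt_mul_right this hL.le
    constructor
    · have : ⌊y⌋₊ < w + 1 := (Nat.floor_lt hy0).2 (by push_cast; exact h4)
      omega
    · have h5 := Nat.lt_floor_add_one y
      have : (w : ℝ) < ⌊y⌋₊ + s := by linarith
      exact_mod_cast this

/-- An empty hypercube of side `S`, in cell widths, contains a cube of cells without points of a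
side greater than `S - 2`. -/
theorem exists_full_of_isEmptyHypercube (hL : 0 < L) (hH : H = 2 * G) (hG : 1 ≤ G)
    (hd : 1 ≤ d) (hx : ∀ j, x j ∈ closedCube a L)
    (hc : ∀ (j : Fin n) (i : Fin d), c j i = ⌊(x j i - a i) * G / L⌋₊) {c' : Fin d → ℝ} {s' : ℝ}
    (h : IsEmptyHypercube a L x c' s') (hs' : 2 ≤ s' * G / L) :
    ∃ u < H ^ (d + 1), Full n d G H c u ∧ s' * G / L - 2 < ((u / H ^ d : ℕ) : ℝ) := by
  classical
  have hG0 : (0 : ℝ) < G := by exact_mod_cast hG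
  obtain ⟨hs0, hsub, hemp⟩ := h
  have hbd := bounds_of_openCube_subset hs0 hsub
  set S := s' * G / L with hS
  let y0 : ℕ → ℝ := fun i => if hi : i < d then (c' ⟨i, hi⟩ - a ⟨i, hi⟩) * G / L else 0
  have hy0 : ∀ i, 0 ≤ y0 i := by
    intro i; dsimp only [y0]; split_ifs with hi
    · exact div_nonneg (mul_nonneg (by linarith [(hbd ⟨i, hi⟩).1]) hG0.le) hL.le
    · exact le_rfl
  have hy0G : ∀ i < d, y0 i + S ≤ G := by
    intro i hi
    simp only [y0, hi, dif_pos, hS]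
    rw [← add_div, div_le_iff₀ hL]
    nlinarith [(hbd ⟨i, hi⟩).2]
  have hfS : 2 ≤ ⌊S⌋₊ := Nat.le_floor (by exact_mod_cast hs')
  have hfloor : ∀ i < d, ⌊y0 i⌋₊ + ⌊S⌋₊ ≤ G := by
    intro i hi
    have h1 := Nat.floor_le (hy0 i)
    have h2 := Nat.floor_le (by linarith : 0 ≤ S)
    have : ((⌊y0 i⌋₊ + ⌊S⌋₊ : ℕ) : ℝ) ≤ G := by push_cast; linarith [hy0G i hi]
    exact_mod_cast this
  have hfG : ⌊S⌋₊ ≤ G := by have := hfloor 0 (by omega); omega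
  -- the lowest cells are `⌊y0 i⌋₊ + 1`; the side must not depend on the axis `i`
  set s := ⌊S⌋₊ - 1 with hs
  let w : ℕ → ℕ := fun i => if i < d then ⌊y0 i⌋₊ + s else s
  have hwH : ∀ i < d + 1, w i < H := by
    intro i hi
    by_cases hid : i < d
    · have := hfloor i hid
      simp only [w, hid, if_true]; omega
    · simp only [w, hid, if_false]; omega
  obtain ⟨u, hu, hdig⟩ := exists_digits H w (d + 1) hwH
  have hus : u / H ^ d = s := by
    have h1 := hdig d (by omega)
    rw [Nat.mod_eq_of_lt] at h1
    · simpa [w] using h1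
    · rw [Nat.div_lt_iff_lt_mul (by apply pow_pos; omega)]; rwa [pow_succ, mul_comm] at hu
  have huw : ∀ i < d, u / H ^ i % H = ⌊y0 i⌋₊ + s := by
    intro i hi
    rw [hdig i (by omega)]; simp [w, hi]
  refine ⟨u, hu, ⟨⟨?_, fun i hi => ?_⟩, fun j hj hbox => hemp ⟨j, hj⟩ fun i => ?_⟩, ?_⟩
  · rw [hus]; omega
  · have := hfloor i hi
    dsimp only
    rw [hus, huw i hi]; omega
  · obtain ⟨h1, h2⟩ := hbox.2 i i.2
    dsimp only at h1 h2
    have hxi := hx ⟨j, hj⟩ i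
    have hci := hc ⟨j, hj⟩ i
    simp only at hci
    rw [huw i i.2, hci] at h1 h2
    rw [hus] at h2
    set y := (x ⟨j, hj⟩ i - a i) * G / L with hy
    have hyn : 0 ≤ y := div_nonneg (mul_nonneg (by linarith [hxi.1]) hG0.le) hL.le
    have hxy : x ⟨j, hj⟩ i = a i + y * L / G := by rw [hy]; field_simp; ring
    have hcy : c' i = a i + y0 i * L / G := by
      simp only [y0, i.2, dif_pos]; field_simp; ring
    have hsS : s' = S * L / G := by rw [hS]; field_simp
    have h3 : y0 i < y := by
      have h4 : ((⌊y0 i⌋₊ + 1 : ℕ) : ℝ) ≤ ⌊y⌋₊ := by exact_mod_cast (by omega)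
      have h5 := Nat.lt_floor_add_one (y0 i)
      have h6 := Nat.floor_le hyn
      push_cast at h4; linarith
    have h4 : y < y0 i + S := by
      have h5 : ((⌊y⌋₊ + 1 : ℕ) : ℝ) ≤ ((⌊y0 i⌋₊ + ⌊S⌋₊ : ℕ) : ℝ) := by
        exact_mod_cast (by omega)
      have h6 := Nat.lt_floor_add_one y
      have h7 := Nat.floor_le (hy0 i)
      have h8 := Nat.floor_le (by linarith : 0 ≤ S)
      push_cast at h5; linarith
    have hLG : 0 < L / G := by positivity
    rw [hxy, hcy, hsS]
    constructor
    · have := mul_lt_mul_of_pos_right h3 hLG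
      rw [mul_div_assoc, mul_div_assoc]; linarith
    · have := mul_lt_mul_of_pos_right h4 hLG
      rw [mul_div_assoc, mul_div_assoc, mul_div_assoc]; linarith
  · rw [hus]
    have h1 := Nat.lt_floor_add_one S
    have h2 : ((s : ℕ) : ℝ) = (⌊S⌋₊ : ℝ) - 1 := by
      rw [hs, Nat.cast_sub (by omega)]; simp
    linarith

variable {ε : ℝ}

theorem two_le_side_of_grid (hd : 1 ≤ d) (hε : 0 < ε) (hε1 : ε < 1) (hL : 0 < L)
    (hfine : 2 * d * (n + 1) ≤ G * ε) : 2 * d / ε ≤ L / (n + 1) * G / L ∧ 2 ≤ 2 * d / ε := by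
  have hd' : (1 : ℝ) ≤ d := by exact_mod_cast hd
  constructor
  · have : L / (n + 1) * G / L = G / (n + 1) := by field_simp
    rw [this, div_le_div_iff₀ hε (by positivity)]
    exact hfine
  · rw [le_div_iff₀ hε]; nlinarith

theorem exists_full (hL : 0 < L) (hH : H = 2 * G) (hG : 1 ≤ G) (hd : 1 ≤ d) (hε : 0 < ε)
    (hε1 : ε < 1) (hfine : 2 * d * (n + 1) ≤ G * ε) (hx : ∀ j, x j ∈ closedCube a L)
    (hc : ∀ (j : Fin n) (i : Fin d), c j i = ⌊(x j i - a i) * G / L⌋₊) :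
    ∃ u < H ^ (d + 1), Full n d G H c u := by
  obtain ⟨c', hc'⟩ := exists_empty_diagonal_cube (x := x) (a := a) hd hL
  obtain ⟨h1, h2⟩ := two_le_side_of_grid (L := L) hd hε hε1 hL hfine
  obtain ⟨u, hu, hf, -⟩ := exists_full_of_isEmptyHypercube hL hH hG hd hx hc hc' (h2.trans h1)
  exact ⟨u, hu, hf⟩

/-- On a grid that is fine enough, a largest cube of cells without points is a good
approximation.  In units of the cell width, every empty cube loses less than `2` when it is
shrunk to a cube of cells, and some empty cube has side at least `2 * d / ε`. -/
theorem isApproxMaxEmptyHypercube_of_full (hL : 0 < L) (hH : H = 2 * G) (hG : 1 ≤ G)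
    (hd : 1 ≤ d) (hε : 0 < ε) (hε1 : ε < 1) (hfine : 2 * d * (n + 1) ≤ G * ε)
    (hx : ∀ j, x j ∈ closedCube a L)
    (hc : ∀ (j : Fin n) (i : Fin d), c j i = ⌊(x j i - a i) * G / L⌋₊) {u : ℕ}
    (hu : Full n d G H c u)
    (hmax : ∀ u' < H ^ (d + 1), Full n d G H c u' → u' / H ^ d ≤ u / H ^ d) :
    IsApproxMaxEmptyHypercube ε a L x
      (fun i => a i + (((u / H ^ (i : ℕ) % H : ℕ) : ℝ) - (((u / H ^ d : ℕ) : ℝ) - 1)) * L / G)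
      (((u / H ^ d : ℕ) : ℝ) * L / G) := by
  have hG0 : (0 : ℝ) < G := by exact_mod_cast hG
  have hd' : (1 : ℝ) ≤ d := by exact_mod_cast hd
  have hE := isEmptyHypercube_of_full hL hG hx hc hu
  refine ⟨hE, fun c' s' h' => ?_⟩
  rw [volume_openCube _ h'.1.le, volume_openCube _ hE.1.le, ← ENNReal.ofReal_mul (by linarith)]
  refine ENNReal.ofReal_le_ofReal ?_
  obtain ⟨h1, h2⟩ := two_le_side_of_grid (L := L) hd hε hε1 hL hfine
  obtain ⟨c₁, s₁, hc₁, hs', hs₁⟩ : ∃ c₁ s₁, IsEmptyHypercube a L x c₁ s₁ ∧ s' ≤ s₁ ∧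
      2 * d / ε ≤ s₁ * G / L := by
    rcases le_total s' (L / (n + 1)) with hle | hle
    · obtain ⟨c₁, hc₁⟩ := exists_empty_diagonal_cube (x := x) (a := a) hd hL
      exact ⟨c₁, _, hc₁, hle, h1⟩
    · refine ⟨c', s', h', le_rfl, h1.trans ?_⟩
      gcongr
  obtain ⟨u', hu', hf, hlt⟩ := exists_full_of_isEmptyHypercube hL hH hG hd hx hc hc₁
    (h2.trans hs₁)
  have hle : ((u' / H ^ d : ℕ) : ℝ) ≤ (u / H ^ d : ℕ) := by exact_mod_cast hmax u' hu' hf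
  have hs₁0 := hc₁.1
  have h3 : (1 - ε / d) * s₁ ≤ ((u / H ^ d : ℕ) : ℝ) * L / G := by
    have h4 : 2 ≤ ε / d * (s₁ * G / L) := by
      calc (2 : ℝ) = ε / d * (2 * d / ε) := by field_simp
        _ ≤ _ := by gcongr
    have h5 : (1 - ε / d) * (s₁ * G / L) ≤ ((u / H ^ d : ℕ) : ℝ) := by linarith
    calc (1 - ε / d) * s₁ = (1 - ε / d) * (s₁ * G / L) * L / G := by field_simp
      _ ≤ _ := by gcongr
  have h6 : ε / d ≤ 1 := by rw [div_le_one (by linarith)]; linarith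
  have h7 : 1 - ε ≤ (1 - ε / d) ^ d := by
    have := one_add_mul_le_pow (a := -(ε / d)) (by linarith) d
    have h8 : (d : ℝ) * -(ε / d) = -ε := by field_simp
    rw [h8] at this
    calc 1 - ε = 1 + -ε := by ring
      _ ≤ _ := this
      _ = _ := by ring
  calc (1 - ε) * s' ^ d ≤ (1 - ε / d) ^ d * s₁ ^ d := by
        have := h'.1.le
        gcongr
    _ = ((1 - ε / d) * s₁) ^ d := (mul_pow _ _ _).symm
    _ ≤ _ := pow_le_pow_left₀ (mul_nonneg (by linarith) hs₁0.le) h3 d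

end Geometry

/-! ### Programs for the parameters, the bases and the table of powers -/

namespace RealRAM

theorem floor_eq_of_eq {y : ℝ} {k : ℕ} (h : y = k) : ⌊y⌋₊ = k := by rw [h, Nat.floor_natCast]

/-- Computes in register 4 the least power `G` of two with `2 * d * (n + 1) ≤ G * ε`, and
`log₂ G + 1` in register 5. -/
def gridProg : Program :=
  (4 ≔ 1 ;; 5 ≔ 1) ;;
  .loop (.lt (.reg 4 * .reg 2) (2 * .reg 1 * (.reg 0 + 1))) (4 ≔ .reg 4 * 2 ;; 5 ≔ .reg 5 + 1)

theorem gridProg_runs {n d g : ℕ} {ε : ℝ} {σ : State} (h0 : σ.reg 0 = n) (h1 : σ.reg 1 = d)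
    (h2 : σ.reg 2 = ε) (hlt : ∀ k < g, ((2 ^ k : ℕ) : ℝ) * ε < 2 * d * (n + 1))
    (hge : 2 * d * (n + 1) ≤ ((2 ^ g : ℕ) : ℝ) * ε) :
    Runs gridProg σ (g * 150 + 60)
      (fun τ => τ.reg 4 = ((2 ^ g : ℕ) : ℝ) ∧ τ.reg 5 = ((g + 1 : ℕ) : ℝ)) := by
  refine Runs.seq (T₁ := 10) (T₂ := g * 150 + 50) (Q₁ := fun τ => τ.reg 4 = 1 ∧ τ.reg 5 = 1)
    (Runs.straight (by simp [Program.run])) (fun σ1 hF1 q1 => ?_) (by omega)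
  refine Runs.loop g (fun k τ => τ.reg 4 = ((2 ^ k : ℕ) : ℝ) ∧ τ.reg 5 = ((k + 1 : ℕ) : ℝ))
    (T := 100) ?_ ?_ ?_ (by omega)
  · simp [q1]
  · rintro k hk τ hF ⟨h4, h5⟩
    have := hlt k hk
    refine ⟨?_, Runs.straight ?_⟩
    · simpa [h4, hF.reg 0, hF.reg 1, hF.reg 2, hF1.reg 0, hF1.reg 1, hF1.reg 2, h0, h1, h2]
        using this
    · simp [Program.run, h4, h5, pow_succ]
  · rintro τ hF ⟨h4, h5⟩
    refine ⟨?_, h4, h5⟩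
    simpa [h4, hF.reg 0, hF.reg 1, hF.reg 2, hF1.reg 0, hF1.reg 1, hF1.reg 2, h0, h1, h2]
      using hge

/-- Computes `H = 2 * G` in register 6, `e = log₂ (H ^ (d + 1))` in register 7 and the number
`B = 2 ^ e` of positions in register 8. -/
def sizeProg : Program :=
  (6 ≔ .reg 4 * 2 ;; 7 ≔ .reg 5 * (.reg 1 + 1) ;; 8 ≔ 1 ;; 15 ≔ 0) ;;
  .loop (.lt (.reg 15) (.reg 7)) (8 ≔ .reg 8 * 2 ;; 15 ≔ .reg 15 + 1)

theorem sizeProg_runs {d g : ℕ} {σ : State} (h1 : σ.reg 1 = d)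
    (h4 : σ.reg 4 = ((2 ^ g : ℕ) : ℝ)) (h5 : σ.reg 5 = ((g + 1 : ℕ) : ℝ)) :
    Runs sizeProg σ ((g + 1) * (d + 1) * 150 + 80)
      (fun τ => τ.reg 6 = ((2 * 2 ^ g : ℕ) : ℝ) ∧ τ.reg 7 = (((g + 1) * (d + 1) : ℕ) : ℝ) ∧
        τ.reg 8 = ((2 ^ ((g + 1) * (d + 1)) : ℕ) : ℝ)) := by
  refine Runs.seq (T₁ := 30) (T₂ := (g + 1) * (d + 1) * 150 + 50)
    (Q₁ := fun τ => τ.reg 6 = ((2 * 2 ^ g : ℕ) : ℝ) ∧ τ.reg 7 = (((g + 1) * (d + 1) : ℕ) : ℝ) ∧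
      τ.reg 8 = 1 ∧ τ.reg 15 = 0)
    (Runs.straight (by simp [Program.run, h1, h4, h5, mul_comm]))
    (fun σ1 hF1 q1 => ?_) (by omega)
  refine Runs.loop ((g + 1) * (d + 1))
    (fun k τ => τ.reg 8 = ((2 ^ k : ℕ) : ℝ) ∧ τ.reg 15 = ((k : ℕ) : ℝ)) (T := 100) ?_ ?_ ?_
    (by omega)
  · simp [q1]
  · rintro k hk τ hF ⟨h8, h15⟩
    refine ⟨?_, Runs.straight ?_⟩
    · rw [Test.holds_lt, Expr.eval_reg, Expr.eval_reg, h15, hF.reg 7, q1.2.1]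
      exact_mod_cast hk
    · simp [Program.run, h8, h15, pow_succ]
  · rintro τ hF ⟨h8, h15⟩
    refine ⟨?_, ?_, ?_, h8⟩
    · rw [Test.holds_lt, Expr.eval_reg, Expr.eval_reg, h15, hF.reg 7, q1.2.1]
      exact lt_irrefl _
    · rw [hF.reg 6, q1.1]
    · rw [hF.reg 7, q1.2.1]

/-- Computes the least `q` with `B * (2 * n - 1) ^ 2 ^ q < (2 * n) ^ 2 ^ q` in register 11 and
`(2 * n) ^ 2 ^ q` in register 9. -/
def powerProg : Program :=
  (9 ≔ 2 * .reg 0 ;; 10 ≔ 2 * .reg 0 - 1 ;; 11 ≔ 0) ;;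
  .loop (.le (.reg 9) (.reg 8 * .reg 10))
    (9 ≔ .reg 9 * .reg 9 ;; 10 ≔ .reg 10 * .reg 10 ;; 11 ≔ .reg 11 + 1)

theorem powerProg_runs {n B q : ℕ} {σ : State} (hn : 1 ≤ n) (h0 : σ.reg 0 = n)
    (h8 : σ.reg 8 = B) (hle : ∀ k < q, (2 * n) ^ 2 ^ k ≤ B * (2 * n - 1) ^ 2 ^ k)
    (hgt : B * (2 * n - 1) ^ 2 ^ q < (2 * n) ^ 2 ^ q) :
    Runs powerProg σ (q * 150 + 80)
      (fun τ => τ.reg 9 = (((2 * n) ^ 2 ^ q : ℕ) : ℝ) ∧ τ.reg 11 = (q : ℝ)) := by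
  have hsub : ((2 * n - 1 : ℕ) : ℝ) = 2 * n - 1 := by rw [Nat.cast_sub (by omega)]; simp
  refine Runs.seq (T₁ := 30) (T₂ := q * 150 + 50)
    (Q₁ := fun τ => τ.reg 9 = ((2 * n : ℕ) : ℝ) ∧ τ.reg 10 = ((2 * n - 1 : ℕ) : ℝ) ∧
      τ.reg 11 = 0)
    (Runs.straight (by simp [Program.run, h0, hsub])) (fun σ1 hF1 q1 => ?_) (by omega)
  refine Runs.loop q
    (fun k τ => τ.reg 9 = (((2 * n) ^ 2 ^ k : ℕ) : ℝ) ∧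
      τ.reg 10 = (((2 * n - 1) ^ 2 ^ k : ℕ) : ℝ) ∧ τ.reg 11 = (k : ℝ)) (T := 100) ?_ ?_ ?_
    (by omega)
  · simp [q1]
  · rintro k hk τ hF ⟨h9, h10, h11⟩
    refine ⟨?_, Runs.straight ?_⟩
    · rw [Test.holds_le, Expr.eval_mul, Expr.eval_reg, Expr.eval_reg, Expr.eval_reg, h9, h10,
        hF.reg 8, hF1.reg 8, h8]
      exact_mod_cast hle k hk
    · simp [Program.run, h9, h10, h11, pow_succ, mul_two, pow_add]
  · rintro τ hF ⟨h9, h10, h11⟩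
    refine ⟨?_, h9, h11⟩
    rw [Test.holds_le, Expr.eval_mul, Expr.eval_reg, Expr.eval_reg, Expr.eval_reg, h9, h10,
        hF.reg 8, hF1.reg 8, h8, not_le]
    exact_mod_cast hgt

/-- Raises register 12 to the power `B = 2 ^ e`. -/
def squareProg : Program :=
  15 ≔ 0 ;;
  .loop (.lt (.reg 15) (.reg 7)) (12 ≔ .reg 12 * .reg 12 ;; 15 ≔ .reg 15 + 1)

theorem squareProg_runs {e : ℕ} {y : ℕ} {σ : State} (h7 : σ.reg 7 = e) (h12 : σ.reg 12 = y) :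
    Runs squareProg σ (e * 150 + 60) (fun τ => τ.reg 12 = ((y ^ 2 ^ e : ℕ) : ℝ)) := by
  refine Runs.seq (T₁ := 10) (T₂ := e * 150 + 50)
    (Q₁ := fun τ => τ.reg 15 = 0)
    (Runs.straight (by simp [Program.run])) (fun σ1 hF1 q1 => ?_) (by omega)
  refine Runs.loop e (fun k τ => τ.reg 12 = ((y ^ 2 ^ k : ℕ) : ℝ) ∧ τ.reg 15 = (k : ℝ))
    (T := 100) ?_ ?_ ?_ (by omega)
  · simp [q1, hF1.reg 12, h12]
  · rintro k hk τ hF ⟨hy, h15⟩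
    refine ⟨?_, Runs.straight ?_⟩
    · rw [Test.holds_lt, Expr.eval_reg, Expr.eval_reg, h15, hF.reg 7, hF1.reg 7, h7]
      exact_mod_cast hk
    · simp [Program.run, hy, h15, pow_succ, mul_two, pow_add]
  · rintro τ hF ⟨hy, h15⟩
    refine ⟨?_, hy⟩
    rw [Test.holds_lt, Expr.eval_reg, Expr.eval_reg, h15, hF.reg 7, hF1.reg 7, h7]
    exact lt_irrefl _

/-- The `m`-th base: `base B A (m + 1)` is the `B`-th power of `base B A m`, and the least base
`2 * B ^ 2 * A` exceeds all sums of digits that occur. -/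
def base (B A m : ℕ) : ℕ := (2 * B ^ 2 * A) ^ B ^ m

theorem base_succ (B A m : ℕ) : base B A (m + 1) = base B A m ^ B := by
  rw [base, base, ← pow_mul, ← pow_succ]

/-- Stores the bases `base B A m`, for `m ≤ 2 * q`, from the address in register 14 on. -/
def baseProg : Program :=
  (12 ≔ 2 * (.reg 8 * .reg 8) * .reg 9 ;; 16 ≔ 0) ;;
  .loop (.lt (.reg 16) (2 * .reg 11))
    (.store (.reg 14 + .reg 16) (.reg 12) ;; squareProg ;; 16 ≔ .reg 16 + 1) ;;
  .store (.reg 14 + .reg 16) (.reg 12)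

theorem baseProg_runs {e q A tw : ℕ} {σ : State} (h7 : σ.reg 7 = e)
    (h8 : σ.reg 8 = ((2 ^ e : ℕ) : ℝ)) (h9 : σ.reg 9 = A) (h11 : σ.reg 11 = q)
    (h14 : σ.reg 14 = tw) :
    Runs baseProg σ (2 * q * (e * 150 + 150) + 100)
      (fun τ => (∀ m ≤ 2 * q, τ.mem (tw + m) = base (2 ^ e) A m) ∧
        ∀ k < tw, τ.mem k = σ.mem k) := by
  refine Runs.seq (T₁ := 30) (T₂ := 2 * q * (e * 150 + 150) + 70)
    (Q₁ := fun τ => τ.reg 12 = (base (2 ^ e) A 0 : ℝ) ∧ τ.reg 16 = 0)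
    (Runs.straight (by simp [Program.run, h8, h9, base, sq])) (fun σ1 hF1 q1 => ?_) (by omega)
  refine Runs.seq (T₁ := 2 * q * (e * 150 + 150) + 50) (T₂ := 20)
    (Q₁ := fun τ => τ.reg 12 = (base (2 ^ e) A (2 * q) : ℝ) ∧ τ.reg 16 = ((2 * q : ℕ) : ℝ) ∧
      (∀ m < 2 * q, τ.mem (tw + m) = base (2 ^ e) A m) ∧ ∀ k < tw, τ.mem k = σ.mem k)
    ?_ (fun σ2 hF2 q2 => ?_) (by omega)
  · refine Runs.loop (2 * q) (fun k τ => τ.reg 12 = (base (2 ^ e) A k : ℝ) ∧ τ.reg 16 = (k : ℝ) ∧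
      (∀ m < k, τ.mem (tw + m) = base (2 ^ e) A m) ∧ ∀ k < tw, τ.mem k = σ.mem k)
      (T := e * 150 + 100) ?_ ?_ ?_ (by simp [add_assoc])
    · simp [q1, hF1.mem]
    · rintro k hk τ hF ⟨hY, h16, hm, hlow⟩
      refine ⟨?_, ?_⟩
      · simp only [Test.holds_lt, Expr.eval_reg, Expr.eval_mul, Expr.eval_two, h16, hF.reg 11,
          hF1.reg 11, h11]
        exact_mod_cast hk
      have haddr : ⌊τ.reg 14 + τ.reg 16⌋₊ = tw + k := floor_eq_of_eq (by
        rw [hF.reg 14, hF1.reg 14, h14, h16]; push_cast; rfl)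
      refine Runs.seq (T₁ := 20) (T₂ := e * 150 + 80) (Q₁ := fun υ =>
          (∀ m < k + 1, υ.mem (tw + m) = base (2 ^ e) A m) ∧ ∀ k < tw, υ.mem k = σ.mem k)
        (Runs.straight ?_) (fun τ1 hG1 r1 => ?_) (by omega)
      · simp only [Program.run, Expr.eval_add, Expr.eval_reg, haddr]
        refine ⟨fun m hmk => ?_, fun l hl => ?_⟩
        · rcases Nat.lt_succ_iff_lt_or_eq.1 hmk with h | rfl
          · rw [Function.update_of_ne (by omega), hm m h]
          · rw [Function.update_self, hY]
        · rw [Function.update_of_ne (by omega), hlow l hl]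
      refine Runs.seq (squareProg_runs (e := e) (y := base (2 ^ e) A k) ?_ ?_)
        (T₂ := 20) (fun τ2 hG2 r2 => Runs.straight ?_) (by omega)
      · rw [hG1.reg 7, hF.reg 7, hF1.reg 7, h7]
      · rw [hG1.reg 12, hY]
      · simp only [Program.run, Expr.eval_add, Expr.eval_reg, Expr.eval_one]
        refine ⟨?_, ?_, ?_, ?_⟩
        · simp [r2, base_succ]
        · simp [hG2.reg 16, hG1.reg 16, h16]
        · simpa [hG2.mem] using r1.1
        · simpa [hG2.mem] using r1.2
    · rintro τ hF ⟨hY, h16, hm, hlow⟩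
      refine ⟨?_, hY, h16, hm, hlow⟩
      simp only [Test.holds_lt, Expr.eval_reg, Expr.eval_mul, Expr.eval_two, h16, hF.reg 11,
          hF1.reg 11, h11]
      push_cast; exact lt_irrefl _
  · obtain ⟨hY, h16, hm, hlow⟩ := q2
    have haddr : ⌊σ2.reg 14 + σ2.reg 16⌋₊ = tw + 2 * q := floor_eq_of_eq (by
        rw [hF2.reg 14, hF1.reg 14, h14, h16]; push_cast; rfl)
    refine Runs.straight ?_
    simp only [Program.run, Expr.eval_add, Expr.eval_reg, haddr]
    refine ⟨fun m hmk => ?_, fun l hl => ?_⟩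
    · rcases Nat.lt_or_eq_of_le hmk with h | rfl
      · rw [Function.update_of_ne (by omega), hm m h]
      · rw [Function.update_self, hY]
    · rw [Function.update_of_ne (by omega), hlow l hl]

/-- Stores the powers `(x ^ H ^ i) ^ c`, where `x` is the content of register 17 and `i ≤ d`,
`c < H`, at the addresses `tb + i * H + c`, where `tb` is the content of register 13. -/
def tableProg : Program :=
  (20 ≔ .reg 17 ;; 18 ≔ 0) ;;
  .loop (.lt (.reg 18) (.reg 1 + 1))
    ((21 ≔ 1 ;; 19 ≔ 0) ;;
    .loop (.lt (.reg 19) (.reg 6))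
      (.store (.reg 13 + .reg 18 * .reg 6 + .reg 19) (.reg 21) ;; 21 ≔ .reg 21 * .reg 20 ;;
      19 ≔ .reg 19 + 1) ;;
    (20 ≔ .reg 21 ;; 18 ≔ .reg 18 + 1))

/-- The memory holds the table that is computed by `tableProg`. -/
def HasTable (d H tb : ℕ) (x : ℝ) (σ : State) : Prop :=
  ∀ i ≤ d, ∀ c < H, σ.mem (tb + i * H + c) = (x ^ H ^ i) ^ c

theorem tableProg_runs {d H tb : ℕ} {x : ℝ} {σ : State} (h1 : σ.reg 1 = d) (h6 : σ.reg 6 = H)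
    (h13 : σ.reg 13 = tb) (h17 : σ.reg 17 = x) :
    Runs tableProg σ ((d + 1) * (H * 150 + 150) + 80)
      (fun τ => HasTable d H tb x τ ∧ τ.reg 20 = x ^ H ^ (d + 1) ∧
        (∀ k < tb, τ.mem k = σ.mem k) ∧
        ∀ k, tb + (d + 1) * H ≤ k → τ.mem k = σ.mem k) := by
  refine Runs.seq (T₁ := 30) (T₂ := (d + 1) * (H * 150 + 150) + 50)
    (Q₁ := fun τ => τ.reg 20 = x ∧ τ.reg 18 = 0)
    (Runs.straight (by simp [Program.run, h17])) (fun σ1 hF1 q1 => ?_) (by omega)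
  refine Runs.loop (d + 1) (fun i τ => τ.reg 20 = x ^ H ^ i ∧ τ.reg 18 = (i : ℝ) ∧
    (∀ i' < i, ∀ c < H, τ.mem (tb + i' * H + c) = (x ^ H ^ i') ^ c) ∧
    (∀ k < tb, τ.mem k = σ.mem k) ∧ ∀ k, tb + (d + 1) * H ≤ k → τ.mem k = σ.mem k)
    (T := H * 150 + 100) ?_ ?_ ?_ (by simp [add_assoc])
  · simp [q1, hF1.mem]
  · rintro i hi τ hF ⟨h20, h18, htab, hlow, hhigh⟩
    have hrow : (i + 1) * H ≤ (d + 1) * H := Nat.mul_le_mul_right _ hi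
    rw [Nat.succ_mul] at hrow
    refine ⟨?_, ?_⟩
    · simp only [Test.holds_lt, Expr.eval_reg, Expr.eval_add, Expr.eval_one, h18, hF.reg 1,
          hF1.reg 1, h1]
      exact_mod_cast hi
    refine Runs.seq (T₁ := 20) (T₂ := H * 150 + 70) (Q₁ := fun τ => τ.reg 21 = 1 ∧ τ.reg 19 = 0)
      (Runs.straight (by simp [Program.run])) (fun τ1 hG1 r1 => ?_) (by omega)
    refine Runs.seq (T₁ := H * 150 + 50) (T₂ := 20) (Q₁ := fun υ => υ.reg 21 = (x ^ H ^ i) ^ H ∧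
      (∀ c < H, υ.mem (tb + i * H + c) = (x ^ H ^ i) ^ c) ∧
      ∀ k, k < tb + i * H ∨ tb + (i + 1) * H ≤ k → υ.mem k = τ.mem k)
      ?_ (fun τ2 hG2 r2 => Runs.straight ?_) (by omega)
    · refine Runs.loop H (fun c υ => υ.reg 21 = (x ^ H ^ i) ^ c ∧ υ.reg 19 = (c : ℝ) ∧
        (∀ c' < c, υ.mem (tb + i * H + c') = (x ^ H ^ i) ^ c') ∧
        ∀ k, k < tb + i * H ∨ tb + (i + 1) * H ≤ k → υ.mem k = τ.mem k) (T := 100)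
        ?_ ?_ ?_ (by omega)
      · simp [r1, hG1.mem]
      · rintro c hc υ hG ⟨h21, h19, hrowc, hrest⟩
        refine ⟨?_, Runs.straight ?_⟩
        · simp only [Test.holds_lt, Expr.eval_reg, h19, hG.reg 6, hG1.reg 6, hF.reg 6,
            hF1.reg 6, h6]
          exact_mod_cast hc
        have haddr : ⌊υ.reg 13 + υ.reg 18 * υ.reg 6 + υ.reg 19⌋₊ = tb + i * H + c :=
          floor_eq_of_eq (by
            rw [hG.reg 13, hG1.reg 13, hF.reg 13, hF1.reg 13, h13, hG.reg 18, hG1.reg 18, h18,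
              hG.reg 6, hG1.reg 6, hF.reg 6, hF1.reg 6, h6, h19]
            push_cast; rfl)
        simp only [Program.run, Expr.eval_add, Expr.eval_reg, Expr.eval_mul, haddr]
        refine ⟨?_, ?_, fun c' hc' => ?_, fun k hk => ?_⟩
        · simp [h21, hG.reg 20, hG1.reg 20, h20, pow_succ]
        · simp [h19]
        · rcases Nat.lt_succ_iff_lt_or_eq.1 hc' with h | rfl
          · rw [Function.update_of_ne (by omega), hrowc c' h]
          · rw [Function.update_self, h21]
        · rw [Nat.succ_mul] at hk
          rw [Function.update_of_ne (by omega), hrest k (by rw [Nat.succ_mul]; exact hk)]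
      · rintro υ hG ⟨h21, h19, hrowc, hrest⟩
        refine ⟨?_, h21, hrowc, hrest⟩
        simp only [Test.holds_lt, Expr.eval_reg, h19, hG.reg 6, hG1.reg 6, hF.reg 6,
            hF1.reg 6, h6]
        exact lt_irrefl _
    · obtain ⟨h21, hrowc, hrest⟩ := r2
      simp only [Program.run, Expr.eval_add, Expr.eval_reg, Expr.eval_one]
      refine ⟨?_, ?_, fun i' hi' c hc => ?_, fun k hk => ?_, fun k hk => ?_⟩
      · simp [h21, pow_succ, pow_mul]
      · simp [hG2.reg 18, hG1.reg 18, h18]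
      · rcases Nat.lt_succ_iff_lt_or_eq.1 hi' with h | rfl
        · have hle : (i' + 1) * H ≤ i * H := Nat.mul_le_mul_right _ h
          rw [Nat.succ_mul] at hle
          rw [hrest _ (Or.inl (by omega)), htab i' h c hc]
        · exact hrowc c hc
      · rw [hrest _ (Or.inl (by omega)), hlow k hk]
      · rw [hrest _ (Or.inr (by rw [Nat.succ_mul]; omega)), hhigh k hk]
  · rintro τ hF ⟨h20, h18, htab, hlow, hhigh⟩
    refine ⟨?_, fun i hi => htab i (by omega), h20, hlow, hhigh⟩
    simp only [Test.holds_lt, Expr.eval_reg, Expr.eval_add, Expr.eval_one, h18, hF.reg 1,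
          hF1.reg 1, h1]
    push_cast; exact lt_irrefl _

end RealRAM

/-! ### Programs for the weights and their powers -/

namespace RealRAM

/-- The content of the table cell for the exponent `c` in row `i`. -/
def tableEntry (i c : Expr) : Expr := .load (.reg 13 + i * .reg 6 + c)

theorem eval_tableEntry {d H tb : ℕ} {x : ℝ} {σ : State} (h : HasTable d H tb x σ)
    (h6 : σ.reg 6 = H) (h13 : σ.reg 13 = tb) {ei ec : Expr} {i c : ℕ} (hi : ei.eval σ = i)
    (hc : ec.eval σ = c) (hid : i ≤ d) (hcH : c < H) :
    (tableEntry ei ec).eval σ = (x ^ H ^ i) ^ c := by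
  have haddr : ⌊σ.reg 13 + ei.eval σ * σ.reg 6 + ec.eval σ⌋₊ = tb + i * H + c :=
    floor_eq_of_eq (by rw [h6, h13, hi, hc]; push_cast; rfl)
  simp only [tableEntry, Expr.eval_load, Expr.eval_add, Expr.eval_mul, Expr.eval_reg, haddr]
  exact h i hid c hcH

/-- The grid coordinate, for the axis in register 18, of the cell of the point in register 23. -/
def cellExpr : Expr :=
  .floor ((.load (.reg 1 + .reg 23 * .reg 1 + .reg 18) - .load (.reg 18)) * .reg 4 / .reg 3)

/-- Computes in register 22 the generating function of the points. -/
def pointProg : Program :=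
  (22 ≔ 0 ;; 23 ≔ 0) ;;
  .loop (.lt (.reg 23) (.reg 0))
    ((24 ≔ 1 ;; 18 ≔ 0) ;;
    .loop (.lt (.reg 18) (.reg 1))
      (24 ≔ .reg 24 * tableEntry (.reg 18) cellExpr ;; 18 ≔ .reg 18 + 1) ;;
    (22 ≔ .reg 22 + .reg 24 ;; 23 ≔ .reg 23 + 1))

theorem pointProg_runs {n d G H tb : ℕ} {L x : ℝ} {c : ℕ → ℕ → ℕ} {σ : State}
    (h0 : σ.reg 0 = n) (h1 : σ.reg 1 = d) (h3 : σ.reg 3 = L) (h4 : σ.reg 4 = G)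
    (h6 : σ.reg 6 = H) (h13 : σ.reg 13 = tb) (htab : HasTable d H tb x σ)
    (hc : ∀ j < n, ∀ i < d, c j i < H ∧
      ((⌊(σ.mem (d + j * d + i) - σ.mem i) * G / L⌋ : ℤ) : ℝ) = c j i) :
    Runs pointProg σ (n * (d * 150 + 150) + 80)
      (fun τ => τ.reg 22 = ∑ j ∈ Finset.range n, ∏ i ∈ Finset.range d, (x ^ H ^ i) ^ c j i) := by
  refine Runs.seq (T₁ := 30) (T₂ := n * (d * 150 + 150) + 50)
    (Q₁ := fun τ => τ.reg 22 = 0 ∧ τ.reg 23 = 0)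
    (Runs.straight (by simp [Program.run])) (fun σ1 hF1 q1 => ?_) (by omega)
  refine Runs.loop n (fun j τ => τ.reg 22 = ∑ j' ∈ Finset.range j, ∏ i ∈ Finset.range d,
    (x ^ H ^ i) ^ c j' i ∧ τ.reg 23 = (j : ℝ)) (T := d * 150 + 100) ?_ ?_ ?_ (by simp [add_assoc])
  · simp [q1]
  · rintro j hj τ hF ⟨h22, h23⟩
    refine ⟨?_, ?_⟩
    · simp only [Test.holds_lt, Expr.eval_reg, h23, hF.reg 0, hF1.reg 0, h0]
      exact_mod_cast hj
    refine Runs.seq (T₁ := 20) (T₂ := d * 150 + 70) (Q₁ := fun τ => τ.reg 24 = 1 ∧ τ.reg 18 = 0)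
      (Runs.straight (by simp [Program.run])) (fun τ1 hG1 r1 => ?_) (by omega)
    refine Runs.seq (T₁ := d * 150 + 50) (T₂ := 20)
      (Q₁ := fun υ => υ.reg 24 = ∏ i ∈ Finset.range d, (x ^ H ^ i) ^ c j i)
      ?_ (fun τ2 hG2 r2 => Runs.straight ?_) (by omega)
    · refine Runs.loop d (fun i υ => υ.reg 24 = ∏ i' ∈ Finset.range i, (x ^ H ^ i') ^ c j i' ∧
        υ.reg 18 = (i : ℝ)) (T := 100) ?_ ?_ ?_ (by omega)
      · simp [r1]
      · rintro i hi υ hG ⟨h24, h18⟩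
        have e1 : υ.reg 1 = d := by rw [hG.reg 1, hG1.reg 1, hF.reg 1, hF1.reg 1, h1]
        have emem : υ.mem = σ.mem := by rw [hG.mem, hG1.mem, hF.mem, hF1.mem]
        refine ⟨?_, Runs.straight ?_⟩
        · simp only [Test.holds_lt, Expr.eval_reg, h18, e1]
          exact_mod_cast hi
        obtain ⟨hcH, hcell⟩ := hc j hj i hi
        have ha1 : ⌊υ.reg 1 + υ.reg 23 * υ.reg 1 + υ.reg 18⌋₊ = d + j * d + i :=
          floor_eq_of_eq (by rw [e1, hG.reg 23, hG1.reg 23, h23, h18]; push_cast; rfl)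
        have ha2 : ⌊υ.reg 18⌋₊ = i := floor_eq_of_eq h18
        have hce : cellExpr.eval υ = c j i := by
          simp only [cellExpr, Expr.eval_floor, Expr.eval_div, Expr.eval_mul, Expr.eval_sub,
            Expr.eval_load, Expr.eval_add, Expr.eval_reg, ha1, ha2, emem]
          rw [hG.reg 4, hG1.reg 4, hF.reg 4, hF1.reg 4, h4, hG.reg 3, hG1.reg 3, hF.reg 3,
            hF1.reg 3, h3, hcell]
        have hent : (tableEntry (.reg 18) cellExpr).eval υ = (x ^ H ^ i) ^ c j i := by
          refine eval_tableEntry (d := d) (tb := tb) ?_ ?_ ?_ h18 hce hi.le hcH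
          · intro i' hi' c' hc'; rw [emem]; exact htab i' hi' c' hc'
          · rw [hG.reg 6, hG1.reg 6, hF.reg 6, hF1.reg 6, h6]
          · rw [hG.reg 13, hG1.reg 13, hF.reg 13, hF1.reg 13, h13]
        simp only [Program.run, Expr.eval_add, Expr.eval_reg, Expr.eval_mul, Expr.eval_one, hent]
        simp [h24, h18, Finset.prod_range_succ]
      · rintro υ hG ⟨h24, h18⟩
        refine ⟨?_, h24⟩
        simp only [Test.holds_lt, Expr.eval_reg, h18, hG.reg 1, hG1.reg 1, hF.reg 1, hF1.reg 1, h1]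
        exact lt_irrefl _
    · simp [Program.run, r2, hG2.reg 22, hG1.reg 22, h22, hG2.reg 23, hG1.reg 23, h23,
        Finset.sum_range_succ]
  · rintro τ hF ⟨h22, h23⟩
    refine ⟨?_, h22⟩
    simp only [Test.holds_lt, Expr.eval_reg, h23, hF.reg 0, hF1.reg 0, h0]
    exact lt_irrefl _

/-- Computes the generating function of the weights in register 30, from that of the points in
register 22. -/
def weightProg : Program :=
  (26 ≔ 0 ;; 27 ≔ 0 ;; 25 ≔ 0) ;;
  .loop (.lt (.reg 25) (.reg 4))
    ((28 ≔ tableEntry (.reg 1) (.reg 25 + 1) ;; 29 ≔ .reg 28 ;; 18 ≔ 0) ;;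
    .loop (.lt (.reg 18) (.reg 1))
      (28 ≔ .reg 28 * ((tableEntry (.reg 18) (.reg 25 + 1) - 1) /
        (tableEntry (.reg 18) 1 - 1)) ;;
      29 ≔ .reg 29 * (tableEntry (.reg 18) (.reg 25) *
        ((tableEntry (.reg 18) (.reg 4 - .reg 25) - 1) / (tableEntry (.reg 18) 1 - 1))) ;;
      18 ≔ .reg 18 + 1) ;;
    (26 ≔ .reg 26 + .reg 28 ;; 27 ≔ .reg 27 + .reg 29 ;; 25 ≔ .reg 25 + 1)) ;;
  30 ≔ .reg 0 * .reg 27 + .reg 0 * ((.reg 20 - 1) / (.reg 17 - 1)) - .reg 22 * .reg 26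

theorem weightProg_runs {n d G H tb : ℕ} {x : ℝ} {σ : State} (hGH : H = 2 * G) (hG1 : 1 ≤ G)
    (h0 : σ.reg 0 = n) (h1 : σ.reg 1 = d) (h4 : σ.reg 4 = G)
    (h6 : σ.reg 6 = H) (h13 : σ.reg 13 = tb) (h17 : σ.reg 17 = x)
    (h20 : σ.reg 20 = x ^ H ^ (d + 1)) (htab : HasTable d H tb x σ) :
    Runs weightProg σ (G * (d * 250 + 200) + 120)
      (fun τ => τ.reg 30 = n * (∑ k ∈ Finset.range G, (∏ i ∈ Finset.range d, ((x ^ H ^ i) ^ k *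
        (((x ^ H ^ i) ^ (G - k) - 1) / (x ^ H ^ i - 1)))) * (x ^ H ^ d) ^ (k + 1)) +
      n * ((x ^ H ^ (d + 1) - 1) / (x - 1)) -
      σ.reg 22 * ∑ k ∈ Finset.range G, (∏ i ∈ Finset.range d,
          (((x ^ H ^ i) ^ (k + 1) - 1) / (x ^ H ^ i - 1))) * (x ^ H ^ d) ^ (k + 1)) := by
  refine Runs.seq (T₁ := 30) (T₂ := G * (d * 250 + 200) + 90)
    (Q₁ := fun τ => τ.reg 26 = 0 ∧ τ.reg 27 = 0 ∧ τ.reg 25 = 0)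
    (Runs.straight (by simp [Program.run])) (fun σ1 hF1 q1 => ?_) (by omega)
  refine Runs.seq (T₁ := G * (d * 250 + 200) + 50) (T₂ := 40)
    (Q₁ := fun τ => τ.reg 26 = ∑ k ∈ Finset.range G, (∏ i ∈ Finset.range d,
          (((x ^ H ^ i) ^ (k + 1) - 1) / (x ^ H ^ i - 1))) * (x ^ H ^ d) ^ (k + 1) ∧
        τ.reg 27 = ∑ k ∈ Finset.range G, (∏ i ∈ Finset.range d, ((x ^ H ^ i) ^ k *
        (((x ^ H ^ i) ^ (G - k) - 1) / (x ^ H ^ i - 1)))) * (x ^ H ^ d) ^ (k + 1))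
    ?_ (fun σ2 hF2 q2 => Runs.straight ?_) (by omega)
  · refine Runs.loop G (fun m τ => τ.reg 26 = ∑ k ∈ Finset.range m, (∏ i ∈ Finset.range d,
          (((x ^ H ^ i) ^ (k + 1) - 1) / (x ^ H ^ i - 1))) * (x ^ H ^ d) ^ (k + 1) ∧
        τ.reg 27 = ∑ k ∈ Finset.range m, (∏ i ∈ Finset.range d, ((x ^ H ^ i) ^ k *
        (((x ^ H ^ i) ^ (G - k) - 1) / (x ^ H ^ i - 1)))) * (x ^ H ^ d) ^ (k + 1) ∧
        τ.reg 25 = (m : ℝ)) (T := d * 250 + 150) ?_ ?_ ?_ (by simp [add_assoc])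
    · simp [q1]
    · rintro m hm τ hF ⟨h26, h27, h25⟩
      have e1 : τ.reg 1 = d := by rw [hF.reg 1, hF1.reg 1, h1]
      have e6 : τ.reg 6 = H := by rw [hF.reg 6, hF1.reg 6, h6]
      have e13 : τ.reg 13 = tb := by rw [hF.reg 13, hF1.reg 13, h13]
      have etab : HasTable d H tb x τ := by
        intro i hi c hc; rw [hF.mem, hF1.mem]; exact htab i hi c hc
      refine ⟨?_, ?_⟩
      · simp only [Test.holds_lt, Expr.eval_reg, h25, hF.reg 4, hF1.reg 4, h4]
        exact_mod_cast hm
      have hent : (tableEntry (.reg 1) (.reg 25 + 1)).eval τ = (x ^ H ^ d) ^ (m + 1) :=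
        eval_tableEntry etab e6 e13 e1 (by simp [h25]) le_rfl (by omega)
      refine Runs.seq (T₁ := 40) (T₂ := d * 250 + 110)
        (Q₁ := fun υ => υ.reg 28 = (x ^ H ^ d) ^ (m + 1) ∧ υ.reg 29 = (x ^ H ^ d) ^ (m + 1) ∧
          υ.reg 18 = 0)
        (Runs.straight (by simp [Program.run, hent])) (fun τ1 hG1 r1 => ?_) (by omega)
      refine Runs.seq (T₁ := d * 250 + 50) (T₂ := 50)
        (Q₁ := fun υ => υ.reg 28 = (∏ i ∈ Finset.range d,
          (((x ^ H ^ i) ^ (m + 1) - 1) / (x ^ H ^ i - 1))) * (x ^ H ^ d) ^ (m + 1) ∧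
          υ.reg 29 = (∏ i ∈ Finset.range d, ((x ^ H ^ i) ^ m *
        (((x ^ H ^ i) ^ (G - m) - 1) / (x ^ H ^ i - 1)))) * (x ^ H ^ d) ^ (m + 1))
        ?_ (fun τ2 hG2 r2 => Runs.straight ?_) (by omega)
      · refine Runs.loop d (fun i υ => υ.reg 28 = (∏ i ∈ Finset.range i,
          (((x ^ H ^ i) ^ (m + 1) - 1) / (x ^ H ^ i - 1))) * (x ^ H ^ d) ^ (m + 1) ∧
          υ.reg 29 = (∏ i ∈ Finset.range i, ((x ^ H ^ i) ^ m *
        (((x ^ H ^ i) ^ (G - m) - 1) / (x ^ H ^ i - 1)))) * (x ^ H ^ d) ^ (m + 1) ∧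
          υ.reg 18 = (i : ℝ)) (T := 200) ?_ ?_ ?_ (by omega)
        · simp [r1]
        · rintro i hi υ hG ⟨h28, h29, h18⟩
          have f6 : υ.reg 6 = H := by rw [hG.reg 6, hG1.reg 6, e6]
          have f13 : υ.reg 13 = tb := by rw [hG.reg 13, hG1.reg 13, e13]
          have f25 : υ.reg 25 = m := by rw [hG.reg 25, hG1.reg 25, h25]
          have f4 : υ.reg 4 = G := by rw [hG.reg 4, hG1.reg 4, hF.reg 4, hF1.reg 4, h4]
          have ftab : HasTable d H tb x υ := by
            intro i hi c hc; rw [hG.mem, hG1.mem]; exact etab i hi c hc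
          refine ⟨?_, Runs.straight ?_⟩
          · simp only [Test.holds_lt, Expr.eval_reg, h18, hG.reg 1, hG1.reg 1, e1]
            exact_mod_cast hi
          have a1 : (tableEntry (.reg 18) (.reg 25 + 1)).eval υ = (x ^ H ^ i) ^ (m + 1) :=
            eval_tableEntry ftab f6 f13 h18 (by simp [f25]) hi.le (by omega)
          have a2 : (tableEntry (.reg 18) 1).eval υ = (x ^ H ^ i) ^ 1 :=
            eval_tableEntry ftab f6 f13 h18 (by simp) hi.le (by omega)
          set υ' : State := ⟨Function.update υ.reg 28 (υ.reg 28 *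
            (((x ^ H ^ i) ^ (m + 1) - 1) / (x ^ H ^ i - 1))), υ.mem⟩ with hυ'
          have hrun : Program.run (28 ≔ .reg 28 * ((tableEntry (.reg 18) (.reg 25 + 1) - 1) /
              (tableEntry (.reg 18) 1 - 1))) υ = υ' := by
            simp [Program.run, a1, a2, hυ']
          have b2 : (tableEntry (.reg 18) 1).eval υ' = (x ^ H ^ i) ^ 1 :=
            eval_tableEntry (σ := υ') ftab (by simpa [hυ'] using f6) (by simpa [hυ'] using f13)
              (by simpa [hυ'] using h18) (by simp) hi.le (by omega)
          have b3 : (tableEntry (.reg 18) (.reg 25)).eval υ' = (x ^ H ^ i) ^ m :=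
            eval_tableEntry (σ := υ') ftab (by simpa [hυ'] using f6) (by simpa [hυ'] using f13)
              (by simpa [hυ'] using h18) (by simpa [hυ'] using f25) hi.le (by omega)
          have b4 : (tableEntry (.reg 18) (.reg 4 - .reg 25)).eval υ' =
              (x ^ H ^ i) ^ (G - m) :=
            eval_tableEntry (σ := υ') ftab (by simpa [hυ'] using f6) (by simpa [hυ'] using f13)
              (by simpa [hυ'] using h18)
              (by rw [Nat.cast_sub hm.le]; simp [hυ', f25, f4]) hi.le (by omega)
          rw [Program.run, hrun]
          simp only [Program.run, Expr.eval_add, Expr.eval_reg, Expr.eval_mul, Expr.eval_one,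
            Expr.eval_div, Expr.eval_sub, b2, b3, b4]
          simp only [hυ', Finset.prod_range_succ]
          refine ⟨?_, ?_, ?_⟩
          · simp [h28]; ring
          · simp [h29]; ring
          · simp [h18]
        · rintro υ hG ⟨h28, h29, h18⟩
          refine ⟨?_, h28, h29⟩
          simp only [Test.holds_lt, Expr.eval_reg, h18, hG.reg 1, hG1.reg 1, e1]
          exact lt_irrefl _
      · simp [Program.run, r2, hG2.reg 26, hG1.reg 26, h26, hG2.reg 27, hG1.reg 27, h27,
          hG2.reg 25, hG1.reg 25, h25, Finset.sum_range_succ]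
    · rintro τ hF ⟨h26, h27, h25⟩
      refine ⟨?_, h26, h27⟩
      simp only [Test.holds_lt, Expr.eval_reg, h25, hF.reg 4, hF1.reg 4, h4]
      exact lt_irrefl _
  · simp [Program.run, q2, hF2.reg 0, hF1.reg 0, h0, hF2.reg 20, hF1.reg 20, h20, hF2.reg 17,
      hF1.reg 17, h17, hF2.reg 22, hF1.reg 22]

theorem Program.run_assign_seq (r : ℕ) (e : Expr) (P : Program) (σ : State) :
    (r ≔ e ;; P).run σ = P.run ⟨Function.update σ.reg r (e.eval σ), σ.mem⟩ := rfl

/-- Replaces the packed digits in register 30 by their `2 ^ q`-th powers. -/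
def digitPowerProg : Program :=
  16 ≔ 2 * .reg 11 ;;
  .loop (.lt 0 (.reg 16))
    (31 ≔ .load (.reg 14 + .reg 16) ;; 32 ≔ .load (.reg 14 + .reg 16 - 1) ;;
    33 ≔ .load (.reg 14 + .reg 16 - 2) ;;
    34 ≔ Expr.rem (.reg 30) (.reg 31 - .reg 32) ;; 34 ≔ .reg 34 * .reg 30 ;;
    34 ≔ Expr.rem (.reg 34) (.reg 31 * .reg 32 - .reg 33) ;;
    30 ≔ Expr.rem (.reg 34) (.reg 32) ;; 16 ≔ .reg 16 - 2)

theorem base_le_base {B A m m' : ℕ} (hB : 1 ≤ B) (hA : 1 ≤ A) (h : m ≤ m') :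
    base B A m ≤ base B A m' := by
  have hpos : 0 < 2 * B ^ 2 * A := by positivity
  exact Nat.pow_le_pow_right hpos (Nat.pow_le_pow_right hB h)

theorem digitPowerProg_runs {B N A q tw : ℕ} {a : ℕ → ℕ} {σ : State} (hB : 2 ≤ B) (hN : 1 ≤ N)
    (hA : A = N ^ 2 ^ q) (ha : ∀ u < B, a u ≤ N) (h11 : σ.reg 11 = q) (h14 : σ.reg 14 = tw)
    (h30 : σ.reg 30 = packed a B (base B A (2 * q)))
    (hmem : ∀ m ≤ 2 * q, σ.mem (tw + m) = base B A m) :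
    Runs digitPowerProg σ (q * 150 + 60)
      (fun τ => τ.reg 30 = packed (fun u => a u ^ 2 ^ q) B (base B A 0)) := by
  have hA1 : 1 ≤ A := hA ▸ Nat.one_le_pow _ _ hN
  refine Runs.seq (T₁ := 10) (T₂ := q * 150 + 50)
    (Q₁ := fun τ => τ.reg 16 = ((2 * q : ℕ) : ℝ))
    (Runs.straight (by simp [Program.run, h11])) (fun σ1 hF1 q1 => ?_) (by omega)
  refine Runs.loop q (fun k τ => τ.reg 16 = ((2 * (q - k) : ℕ) : ℝ) ∧
    τ.reg 30 = packed (fun u => a u ^ 2 ^ k) B (base B A (2 * (q - k)))) (T := 100) ?_ ?_ ?_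
    (by omega)
  · simp [q1, hF1.reg 30, h30]
  · rintro k hk τ hF ⟨h16, hV⟩
    obtain ⟨m, hm⟩ : ∃ m, q - k = m + 1 := ⟨q - k - 1, by omega⟩
    have hm' : q - (k + 1) = m := by omega
    rw [hm] at h16 hV
    rw [hm']
    refine ⟨?_, Runs.straight ?_⟩
    · simp only [Test.holds_lt, Expr.eval_zero, Expr.eval_reg, h16]
      push_cast; positivity
    have e14 : τ.reg 14 = tw := by rw [hF.reg 14, hF1.reg 14, h14]
    have emem : τ.mem = σ.mem := by rw [hF.mem, hF1.mem]
    have ad0 : ⌊τ.reg 14 + τ.reg 16⌋₊ = tw + (2 * m + 2) :=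
      floor_eq_of_eq (by rw [e14, h16]; push_cast; ring)
    have ad1 : ⌊τ.reg 14 + τ.reg 16 - 1⌋₊ = tw + (2 * m + 1) :=
      floor_eq_of_eq (by rw [e14, h16]; push_cast; ring)
    have ad2 : ⌊τ.reg 14 + τ.reg 16 - 2⌋₊ = tw + 2 * m :=
      floor_eq_of_eq (by rw [e14, h16]; push_cast; ring)
    have m0 : σ.mem (tw + (2 * m + 2)) = base B A (2 * m + 2) := hmem _ (by omega)
    have m1 : σ.mem (tw + (2 * m + 1)) = base B A (2 * m + 1) := hmem _ (by omega)
    have m2 : σ.mem (tw + 2 * m) = base B A (2 * m) := hmem _ (by omega)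
    have hsq : 2 * B ^ 2 * (N ^ 2 ^ k) ^ 2 ≤ base B A (2 * m) := by
      refine le_trans ?_ (base_le_base (by omega) hA1 (Nat.zero_le _))
      rw [base, pow_zero, pow_one, hA, ← pow_mul, ← pow_succ]
      exact Nat.mul_le_mul_left _ (Nat.pow_le_pow_right hN
        (Nat.pow_le_pow_right (by omega) hk))
    have key := packed_square (a := fun u => a u ^ 2 ^ k) hB (Nat.one_le_pow _ _ hN)
      (fun u hu => Nat.pow_le_pow_left (ha u hu) _) hsq
    rw [← base_succ, ← base_succ] at key
    have hpow : (fun u => (a u ^ 2 ^ k) ^ 2) = fun u => a u ^ 2 ^ (k + 1) := by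
      funext u; rw [← pow_mul, ← pow_succ]
    rw [hpow] at key
    have hle1 : base B A (2 * m + 1) ≤ base B A (2 * m + 2) :=
      base_le_base (by omega) hA1 (by omega)
    have hle2 : base B A (2 * m) ≤ base B A (2 * m + 2) * base B A (2 * m + 1) :=
      (base_le_base (by omega) hA1 (by omega)).trans
        (Nat.le_mul_of_pos_right _ (lt_of_lt_of_le (by simp only [base]; positivity)
          (base_le_base (m := 0) (by omega) hA1 (Nat.zero_le _))))
    set V := packed (fun u => a u ^ 2 ^ k) B (base B A (2 * m + 2))
    -- the values of the registers 30 to 34 during one round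
    have step : ∀ υ : State, υ.reg 31 = base B A (2 * m + 2) → υ.reg 32 = base B A (2 * m + 1) →
        υ.reg 33 = base B A (2 * m) → υ.reg 30 = V → υ.reg 16 = ((2 * m + 2 : ℕ) : ℝ) →
        ((34 ≔ Expr.rem (.reg 30) (.reg 31 - .reg 32) ;; 34 ≔ .reg 34 * .reg 30 ;;
          34 ≔ Expr.rem (.reg 34) (.reg 31 * .reg 32 - .reg 33) ;;
          30 ≔ Expr.rem (.reg 34) (.reg 32) ;; 16 ≔ .reg 16 - 2).run υ).reg 16 =
            ((2 * m : ℕ) : ℝ) ∧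
        ((34 ≔ Expr.rem (.reg 30) (.reg 31 - .reg 32) ;; 34 ≔ .reg 34 * .reg 30 ;;
          34 ≔ Expr.rem (.reg 34) (.reg 31 * .reg 32 - .reg 33) ;;
          30 ≔ Expr.rem (.reg 34) (.reg 32) ;; 16 ≔ .reg 16 - 2).run υ).reg 30 =
            packed (fun u => a u ^ 2 ^ (k + 1)) B (base B A (2 * m)) := by
      intro υ g31 g32 g33 g30 g16
      have s1 : (Expr.rem (.reg 30) (.reg 31 - .reg 32)).eval υ =
          ((V % (base B A (2 * m + 2) - base B A (2 * m + 1)) : ℕ) : ℝ) :=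
        Expr.eval_rem g30 (by rw [Nat.cast_sub hle1]; simp [g31, g32])
      rw [Program.run_assign_seq, s1]
      obtain ⟨υ₁, hυ₁⟩ : ∃ υ₁ : State, υ₁ = ⟨Function.update υ.reg 34
        ((V % (base B A (2 * m + 2) - base B A (2 * m + 1)) : ℕ) : ℝ), υ.mem⟩ := ⟨_, rfl⟩
      rw [← hυ₁, Program.run_assign_seq]
      have s2 : (Expr.reg 34 * Expr.reg 30).eval υ₁ =
          ((V % (base B A (2 * m + 2) - base B A (2 * m + 1)) * V : ℕ) : ℝ) := by
        simp [hυ₁, g30]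
      rw [s2]
      obtain ⟨υ₂, hυ₂⟩ : ∃ υ₂ : State, υ₂ = ⟨Function.update υ₁.reg 34
        ((V % (base B A (2 * m + 2) - base B A (2 * m + 1)) * V : ℕ) : ℝ), υ₁.mem⟩ := ⟨_, rfl⟩
      rw [← hυ₂, Program.run_assign_seq]
      have s3 : (Expr.rem (.reg 34) (.reg 31 * .reg 32 - .reg 33)).eval υ₂ =
          ((V % (base B A (2 * m + 2) - base B A (2 * m + 1)) * V %
            (base B A (2 * m + 2) * base B A (2 * m + 1) - base B A (2 * m)) : ℕ) : ℝ) :=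
        Expr.eval_rem (by simp [hυ₂])
          (by rw [Nat.cast_sub hle2]; simp [hυ₂, hυ₁, g31, g32, g33])
      rw [s3, Program.run_assign_seq, Expr.eval_rem
        (x := V % (base B A (2 * m + 2) - base B A (2 * m + 1)) * V %
            (base B A (2 * m + 2) * base B A (2 * m + 1) - base B A (2 * m)))
        (y := base B A (2 * m + 1)) ?_ ?_, key]
      · simp [Program.run, hυ₂, hυ₁, g16]
      · simp
      · simp [hυ₂, hυ₁, g32]
    have hrun := step ((31 ≔ .load (.reg 14 + .reg 16) ;; 32 ≔ .load (.reg 14 + .reg 16 - 1) ;;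
      33 ≔ .load (.reg 14 + .reg 16 - 2)).run τ)
      (by simp [Program.run, ad0, emem, m0])
      (by simp [Program.run, ad1, emem, m1])
      (by simp [Program.run, ad2, emem, m2])
      (by simp [Program.run]; exact hV)
      (by simp [Program.run, h16]; ring)
    exact hrun
  · rintro τ hF ⟨h16, hV⟩
    rw [Nat.sub_self, Nat.mul_zero] at h16 hV
    exact ⟨by simp [h16], hV⟩

end RealRAM

/-! ### Programs for the search and the output -/

namespace RealRAM

/-- Scans the `H` digits of register 37 in the base that is given in register 41.  The last digit
whose own digit sum in base `Y` (register 35) is at least `A` (register 9) is copied to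
register 40, and its index is stored. -/
def scanProg : Program :=
  .loop (.lt (.reg 38) (.reg 6))
    (39 ≔ Expr.rem (.reg 37) (.reg 41) ;;
    .ite (.le (.reg 9) (Expr.rem (.reg 39) (.reg 35 - 1)))
      (.store (.reg 36 + .reg 18) (.reg 38) ;; 40 ≔ .reg 39) .skip ;;
    (37 ≔ .floor (.reg 37 / .reg 41) ;; 38 ≔ .reg 38 + 1))

theorem scanProg_runs {H A Y V R wb i k : ℕ} {σ : State} (hY : 1 ≤ Y)
    (h6 : σ.reg 6 = H) (h9 : σ.reg 9 = A) (h18 : σ.reg 18 = i) (h35 : σ.reg 35 = Y)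
    (h36 : σ.reg 36 = wb) (h37 : σ.reg 37 = V) (h38 : σ.reg 38 = 0) (h41 : σ.reg 41 = R)
    (hk : k < H) (hT : A ≤ V / R ^ k % R % (Y - 1))
    (hlast : ∀ v, k < v → v < H → V / R ^ v % R % (Y - 1) < A) :
    Runs scanProg σ (H * 150 + 50)
      (fun τ => τ.reg 40 = ((V / R ^ k % R : ℕ) : ℝ) ∧ τ.mem (wb + i) = k ∧
        ∀ l, l ≠ wb + i → τ.mem l = σ.mem l) := by
  refine Runs.loop H (fun v τ => τ.reg 37 = ((V / R ^ v : ℕ) : ℝ) ∧ τ.reg 38 = (v : ℝ) ∧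
    (k < v → τ.reg 40 = ((V / R ^ k % R : ℕ) : ℝ) ∧ τ.mem (wb + i) = k) ∧
    ∀ l, l ≠ wb + i → τ.mem l = σ.mem l) (T := 100) ?_ ?_ ?_ (by omega)
  · simp [h37, h38]
  · rintro v hv τ hF ⟨g37, g38, g40, grest⟩
    refine ⟨?_, ?_⟩
    · simp only [Test.holds_lt, Expr.eval_reg, g38, hF.reg 6, h6]
      exact_mod_cast hv
    have e41 : τ.reg 41 = R := by rw [hF.reg 41, h41]
    have hrem : (Expr.rem (.reg 37) (.reg 41)).eval τ = ((V / R ^ v % R : ℕ) : ℝ) :=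
      Expr.eval_rem g37 e41
    refine Runs.seq (T₁ := 20) (T₂ := 80) (Q₁ := fun υ => υ.reg 39 = ((V / R ^ v % R : ℕ) : ℝ))
      (Runs.straight (by simp [Program.run, hrem])) (fun τ1 hG1 r1 => ?_) (by omega)
    have haddr : ⌊τ1.reg 36 + τ1.reg 18⌋₊ = wb + i := floor_eq_of_eq (by
      rw [hG1.reg 36, hF.reg 36, h36, hG1.reg 18, hF.reg 18, h18]; push_cast; rfl)
    have htest : (Test.le (.reg 9) (Expr.rem (.reg 39) (.reg 35 - 1))).Holds τ1 ↔
        A ≤ V / R ^ v % R % (Y - 1) := by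
      rw [Test.holds_le, Expr.eval_rem (σ := τ1) (e := .reg 39) (f := .reg 35 - 1)
        (x := V / R ^ v % R) (y := Y - 1) r1
        (by rw [Nat.cast_sub hY]; simp [hG1.reg 35, hF.reg 35, h35]), Expr.eval_reg, hG1.reg 9,
        hF.reg 9, h9, Nat.cast_le]
    refine Runs.seq (T₁ := 50) (T₂ := 30) (Q₁ := fun υ =>
      (k < v + 1 → υ.reg 40 = ((V / R ^ k % R : ℕ) : ℝ) ∧ υ.mem (wb + i) = k) ∧
      ∀ l, l ≠ wb + i → υ.mem l = σ.mem l)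
      (Runs.straight ?_) (fun τ2 hG2 r2 => Runs.straight ?_) (by omega)
    · by_cases hv' : A ≤ V / R ^ v % R % (Y - 1)
      · have hvk : v ≤ k := by
          by_contra hlt
          exact absurd (hlast v (by omega) hv) (by omega)
        rw [Program.run, if_pos (htest.2 hv')]
        simp only [Program.run, Expr.eval_add, Expr.eval_reg, haddr]
        refine ⟨fun hkv => ?_, fun l hl => ?_⟩
        · obtain rfl : k = v := by omega
          refine ⟨?_, ?_⟩
          · rw [Function.update_self, r1]
          · rw [Function.update_self, hG1.reg 38, g38]
        · rw [Function.update_of_ne hl, hG1.mem, grest l hl]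
      · rw [Program.run, if_neg (fun h => hv' (htest.1 h))]
        simp only [Program.run]
        have hkv : k ≠ v := by rintro rfl; exact hv' hT
        refine ⟨fun hlt => ?_, fun l hl => ?_⟩
        · rw [hG1.reg 40, hG1.mem]; exact g40 (by omega)
        · rw [hG1.mem, grest l hl]
    · have hdiv : (Expr.floor (.reg 37 / .reg 41)).eval τ2 = ((V / R ^ v / R : ℕ) : ℝ) :=
        Expr.eval_floor_div (by rw [Expr.eval_reg, hG2.reg 37, hG1.reg 37, g37])
          (by rw [Expr.eval_reg, hG2.reg 41, hG1.reg 41, e41])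
      simp only [Program.run, hdiv]
      rw [Nat.div_div_eq_div_mul, ← pow_succ]
      refine ⟨by simp, ?_, ?_, ?_⟩
      · simp [hG2.reg 38, hG1.reg 38, g38]
      · simpa using r2.1
      · simpa using r2.2
  · rintro τ hF ⟨g37, g38, g40, grest⟩
    refine ⟨?_, (g40 hk).1, (g40 hk).2, grest⟩
    simp only [Test.holds_lt, Expr.eval_reg, g38, hF.reg 6, h6]
    exact lt_irrefl _

/-- Stores the digits in base `H` of the last position in register 30 that holds the digit `A`,
beginning with the most significant one. -/
def searchProg : Program :=
  (36 ≔ .reg 14 + 2 * .reg 11 + 1 ;; 18 ≔ .reg 1 + 1) ;;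
  .loop (.lt 0 (.reg 18))
    ((18 ≔ .reg 18 - 1 ;; 41 ≔ tableEntry (.reg 18) 1 ;; 37 ≔ .reg 30 ;; 38 ≔ 0) ;;
    scanProg ;; 30 ≔ .reg 40)

theorem searchProg_runs {d q H A Y tb tw u₀ : ℕ} {b : ℕ → ℕ} {σ : State}
    (hH : 2 ≤ H) (hA : 1 ≤ A) (hY : H ^ (d + 1) * A + 1 < Y)
    (hb : ∀ u < H ^ (d + 1), b u ≤ A)
    (hsmall : ∀ u < H ^ (d + 1), b u < A → H ^ (d + 1) * b u < A)
    (hu₀ : u₀ < H ^ (d + 1)) (hfull : b u₀ = A) (hmax : ∀ u < H ^ (d + 1), b u = A → u ≤ u₀)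
    (h1 : σ.reg 1 = d) (h6 : σ.reg 6 = H) (h9 : σ.reg 9 = A) (h11 : σ.reg 11 = q)
    (h13 : σ.reg 13 = tb) (h14 : σ.reg 14 = tw) (htw : tb + (d + 1) * H ≤ tw)
    (h35 : σ.reg 35 = Y) (h30 : σ.reg 30 = packed b (H ^ (d + 1)) Y)
    (htab : HasTable d H tb Y σ) :
    Runs searchProg σ ((d + 1) * (H * 150 + 200) + 80)
      (fun τ => τ.reg 36 = ((tw + 2 * q + 1 : ℕ) : ℝ) ∧
        (∀ i ≤ d, τ.mem (tw + 2 * q + 1 + i) = ((u₀ / H ^ i % H : ℕ) : ℝ)) ∧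
        ∀ k < tw, τ.mem k = σ.mem k) := by
  have hH0 : 0 < H := by omega
  -- a block of positions contains a full one if and only if its digit sum is at least `A`
  have hsum : ∀ p i, i ≤ d + 1 → p * H ^ i + H ^ i ≤ H ^ (d + 1) →
      packed (fun t => b (p * H ^ i + t)) (H ^ i) Y % (Y - 1) =
        ∑ t ∈ Finset.range (H ^ i), b (p * H ^ i + t) := by
    intro p i hi hp
    apply packed_mod_pred
    calc ∑ t ∈ Finset.range (H ^ i), b (p * H ^ i + t) ≤ ∑ t ∈ Finset.range (H ^ i), A :=
          Finset.sum_le_sum fun t ht => hb _ (by rw [Finset.mem_range] at ht; omega)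
      _ = H ^ i * A := by simp
      _ ≤ H ^ (d + 1) * A := Nat.mul_le_mul_right _ (by omega)
      _ < Y - 1 := by omega
  set wb := tw + 2 * q + 1 with hwb
  refine Runs.seq (T₁ := 30) (T₂ := (d + 1) * (H * 150 + 200) + 50)
    (Q₁ := fun τ => τ.reg 36 = (wb : ℝ) ∧ τ.reg 18 = ((d + 1 : ℕ) : ℝ))
    (Runs.straight (by simp [Program.run, h14, h11, h1, hwb])) (fun σ1 hF1 q1 => ?_) (by omega)
  refine Runs.loop (d + 1) (fun m τ => τ.reg 18 = ((d + 1 - m : ℕ) : ℝ) ∧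
    τ.reg 30 = packed (fun t => b (u₀ / H ^ (d + 1 - m) * H ^ (d + 1 - m) + t))
      (H ^ (d + 1 - m)) Y ∧
    (∀ i ≤ d, d + 1 - m ≤ i → τ.mem (wb + i) = ((u₀ / H ^ i % H : ℕ) : ℝ)) ∧
    ∀ k < tw, τ.mem k = σ.mem k) (T := H * 150 + 150) ?_ ?_ ?_ (by simp [add_assoc])
  · simp only [Nat.sub_zero, q1, hF1.reg 30, h30, hF1.mem, Nat.div_eq_of_lt hu₀, zero_mul,
      zero_add, implies_true, and_true, true_and]
    intro i hi hi'; omega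
  · rintro m hm τ hF ⟨h18, hV, hdig, hlow⟩
    obtain ⟨i, hi⟩ : ∃ i, d + 1 - m = i + 1 := ⟨d - m, by omega⟩
    have hi' : d + 1 - (m + 1) = i := by omega
    rw [hi] at h18 hV hdig
    rw [hi']
    have hid : i ≤ d := by omega
    refine ⟨?_, ?_⟩
    · simp only [Test.holds_lt, Expr.eval_zero, Expr.eval_reg, h18]
      push_cast; positivity
    set P := u₀ / H ^ (i + 1) with hP
    set V := packed (fun t => b (P * H ^ (i + 1) + t)) (H ^ (i + 1)) Y with hVdef
    set R := Y ^ H ^ i with hR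
    set k := u₀ / H ^ i % H with hkdef
    have hPk : P * H + k = u₀ / H ^ i := by
      rw [hP, pow_succ, ← Nat.div_div_eq_div_mul, hkdef]
      exact Nat.div_add_mod' _ _
    have hPB : P * H ^ (i + 1) + H ^ (i + 1) ≤ H ^ (d + 1) := by
      obtain ⟨r, hr⟩ : ∃ r, d + 1 = i + 1 + r := Nat.exists_eq_add_of_le (by omega)
      have : P < H ^ r := by
        rw [hP, Nat.div_lt_iff_lt_mul (by positivity), ← pow_add, add_comm r, ← hr]
        exact hu₀
      rw [hr, pow_add _ (i + 1) r]
      calc P * H ^ (i + 1) + H ^ (i + 1) = H ^ (i + 1) * (P + 1) := by ring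
        _ ≤ _ := Nat.mul_le_mul_left _ this
    have hblock : ∀ v < H, (P * H + v) * H ^ i + H ^ i ≤ H ^ (d + 1) := by
      intro v hv
      have : H ^ i * (v + 1) ≤ H ^ i * H := Nat.mul_le_mul_left _ hv
      calc (P * H + v) * H ^ i + H ^ i = P * H ^ (i + 1) + H ^ i * (v + 1) := by ring
        _ ≤ P * H ^ (i + 1) + H ^ i * H := by omega
        _ ≤ _ := by rw [← pow_succ]; exact hPB
    have hslice : ∀ v < H, V / R ^ v % R =
        packed (fun t => b ((P * H + v) * H ^ i + t)) (H ^ i) Y := by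
      intro v hv
      rw [hR, ← pow_mul, hVdef, packed_slice ?_ ?_]
      · congr 1; funext t; congr 1; ring
      · intro u hu
        have h2 := hb (P * H ^ (i + 1) + u) (by omega)
        have h3 : 1 * A ≤ H ^ (d + 1) * A := Nat.mul_le_mul_right _ (Nat.one_le_pow _ _ hH0)
        omega
      · calc H ^ i * v + H ^ i = H ^ i * (v + 1) := by ring
          _ ≤ H ^ i * H := Nat.mul_le_mul_left _ hv
          _ = H ^ (i + 1) := (pow_succ _ _).symm
    have hkH : k < H := Nat.mod_lt _ hH0
    have hT : A ≤ V / R ^ k % R % (Y - 1) := by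
      rw [hslice k hkH, hsum _ i (by omega) (hblock k hkH), hPk]
      have hmem : u₀ % H ^ i ∈ Finset.range (H ^ i) :=
        Finset.mem_range.2 (Nat.mod_lt _ (by positivity))
      calc A = b (u₀ / H ^ i * H ^ i + u₀ % H ^ i) := by rw [Nat.div_add_mod', hfull]
        _ ≤ _ := Finset.single_le_sum (f := fun t => b (u₀ / H ^ i * H ^ i + t))
          (fun _ _ => Nat.zero_le _) hmem
    have hlast : ∀ v, k < v → v < H → V / R ^ v % R % (Y - 1) < A := by
      intro v hkv hv
      rw [hslice v hv, hsum _ i (by omega) (hblock v hv)]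
      have hlt : ∀ t ∈ Finset.range (H ^ i),
          H ^ (d + 1) * b ((P * H + v) * H ^ i + t) ≤ A - 1 := by
        intro t ht
        rw [Finset.mem_range] at ht
        have hu : (P * H + v) * H ^ i + t < H ^ (d + 1) := by have := hblock v hv; omega
        have hgt : u₀ < (P * H + v) * H ^ i + t := by
          have h2 : (u₀ / H ^ i + 1) * H ^ i ≤ (P * H + v) * H ^ i :=
            Nat.mul_le_mul_right _ (by omega)
          have h3 := Nat.div_add_mod' u₀ (H ^ i)
          have h4 := Nat.mod_lt u₀ (by positivity : 0 < H ^ i)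
          rw [Nat.succ_mul] at h2
          omega
        have hne : b ((P * H + v) * H ^ i + t) ≠ A := fun h => by
          have := hmax _ hu h; omega
        have := hsmall _ hu (lt_of_le_of_ne (hb _ hu) hne)
        omega
      have h2 := Finset.sum_le_sum hlt
      rw [← Finset.mul_sum, Finset.sum_const, Finset.card_range, smul_eq_mul] at h2
      have h3 : H ^ i * (A - 1) ≤ H ^ (d + 1) * (A - 1) :=
        Nat.mul_le_mul_right _ (Nat.pow_le_pow_right hH0 (by omega))
      have h4 := Nat.le_of_mul_le_mul_left (h2.trans h3) (by positivity)
      omega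
    have e13 : τ.reg 13 = tb := by rw [hF.reg 13, hF1.reg 13, h13]
    have e6 : τ.reg 6 = H := by rw [hF.reg 6, hF1.reg 6, h6]
    have htab' : HasTable d H tb Y ⟨Function.update τ.reg 18 (i : ℝ), τ.mem⟩ := by
      intro i' hi'' c hc
      have hrow : (i' + 1) * H ≤ (d + 1) * H := Nat.mul_le_mul_right _ (by omega)
      rw [Nat.succ_mul] at hrow
      simp only
      rw [hlow _ (by omega)]
      exact htab i' hi'' c hc
    have hent : (tableEntry (.reg 18) 1).eval ⟨Function.update τ.reg 18 (i : ℝ), τ.mem⟩ =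
        ((Y : ℝ) ^ H ^ i) ^ 1 :=
      eval_tableEntry htab' (by simpa using e6) (by simpa using e13) (by simp) (by simp) hid
        (by omega)
    have h18' : τ.reg 18 - 1 = i := by rw [h18]; push_cast; ring
    refine Runs.seq (T₁ := 50) (T₂ := H * 150 + 90)
      (Q₁ := fun υ => υ.reg 18 = (i : ℝ) ∧ υ.reg 41 = (R : ℝ) ∧ υ.reg 37 = (V : ℝ) ∧
        υ.reg 38 = 0 ∧ υ.mem = τ.mem)
      (Runs.straight ?_) (fun τ1 hG1 r1 => ?_) (by omega)
    · simp only [Program.run, Expr.eval_sub, Expr.eval_reg, Expr.eval_one, h18', hent]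
      simp [hR, hV]
    obtain ⟨r18, r41, r37, r38, rmem⟩ := r1
    refine Runs.seq (scanProg_runs (H := H) (A := A) (Y := Y) (V := V) (R := R) (wb := wb)
      (i := i) (k := k) (by omega) ?_ ?_ r18 ?_ ?_ r37 r38 r41 hkH hT hlast) (T₂ := 20)
      (fun τ2 hG2 r2 => Runs.straight ?_) (by omega)
    · rw [hG1.reg 6, e6]
    · rw [hG1.reg 9, hF.reg 9, hF1.reg 9, h9]
    · rw [hG1.reg 35, hF.reg 35, hF1.reg 35, h35]
    · rw [hG1.reg 36, hF.reg 36, q1.1]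
    · obtain ⟨g40, gi, grest⟩ := r2
      simp only [Program.run, Expr.eval_reg]
      refine ⟨?_, ?_, fun i' hi1 hi2 => ?_, fun l hl => ?_⟩
      · simp [hG2.reg 18, r18]
      · rw [Function.update_self, g40, hslice k hkH, hPk]
      · rcases Nat.lt_or_eq_of_le hi2 with h | rfl
        · rw [grest _ (by omega), rmem, hdig i' hi1 h]
        · exact gi
      · rw [grest _ (by omega), rmem, hlow l hl]
  · rintro τ hF ⟨h18, hV, hdig, hlow⟩
    refine ⟨?_, ?_, fun i hi => hdig i hi (by omega), hlow⟩
    · simp [h18]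
    · rw [hF.reg 36, q1.1]

/-- Writes the output, from the digits that `searchProg` has stored. -/
def outputProg : Program :=
  (25 ≔ .load (.reg 36 + .reg 1) ;; 18 ≔ 0) ;;
  .loop (.lt (.reg 18) (.reg 1))
    (.store (.reg 18) (.load (.reg 18) +
      (.load (.reg 36 + .reg 18) - (.reg 25 - 1)) * .reg 3 / .reg 4) ;;
    18 ≔ .reg 18 + 1) ;;
  0 ≔ .reg 25 * .reg 3 / .reg 4

theorem outputProg_runs {d wb : ℕ} {L G : ℝ} {w : ℕ → ℝ} {σ : State} (hd : d ≤ wb)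
    (h1 : σ.reg 1 = d) (h3 : σ.reg 3 = L) (h4 : σ.reg 4 = G) (h36 : σ.reg 36 = wb)
    (hw : ∀ i ≤ d, σ.mem (wb + i) = w i) :
    Runs outputProg σ (d * 150 + 100)
      (fun τ => τ.reg 0 = w d * L / G ∧
        ∀ i < d, τ.mem i = σ.mem i + (w i - (w d - 1)) * L / G) := by
  have haddr0 : ⌊σ.reg 36 + σ.reg 1⌋₊ = wb + d := floor_eq_of_eq (by
      rw [h36, h1]; push_cast; rfl)
  refine Runs.seq (T₁ := 30) (T₂ := d * 150 + 70)
    (Q₁ := fun τ => τ.reg 25 = w d ∧ τ.reg 18 = 0)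
    (Runs.straight (by simp [Program.run, haddr0, hw])) (fun σ1 hF1 q1 => ?_) (by omega)
  refine Runs.seq (T₁ := d * 150 + 50) (T₂ := 20)
    (Q₁ := fun τ => ∀ i < d, τ.mem i = σ.mem i + (w i - (w d - 1)) * L / G)
    ?_ (fun σ2 hF2 q2 => Runs.straight ?_) (by omega)
  · refine Runs.loop d (fun m τ => τ.reg 18 = (m : ℝ) ∧
      (∀ i < m, τ.mem i = σ.mem i + (w i - (w d - 1)) * L / G) ∧
      ∀ l, m ≤ l → τ.mem l = σ.mem l) (T := 100) ?_ ?_ ?_ (by omega)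
    · simp [q1, hF1.mem]
    · rintro m hm τ hF ⟨h18, hdone, hrest⟩
      have ha1 : ⌊τ.reg 18⌋₊ = m := floor_eq_of_eq h18
      have ha2 : ⌊τ.reg 36 + τ.reg 18⌋₊ = wb + m := floor_eq_of_eq (by
        rw [hF.reg 36, hF1.reg 36, h36, h18]; push_cast; rfl)
      refine ⟨?_, Runs.straight ?_⟩
      · simp only [Test.holds_lt, Expr.eval_reg, h18, hF.reg 1, hF1.reg 1, h1]
        exact_mod_cast hm
      simp only [Program.run, Expr.eval_add, Expr.eval_reg, Expr.eval_load, Expr.eval_mul,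
        Expr.eval_sub, Expr.eval_div, Expr.eval_one, ha1, ha2, hF.reg 25, q1.1, hF.reg 3,
        hF1.reg 3, h3, hF.reg 4, hF1.reg 4, h4]
      refine ⟨?_, fun i hi => ?_, fun l hl => ?_⟩
      · simp [h18]
      · rcases Nat.lt_succ_iff_lt_or_eq.1 hi with h | rfl
        · rw [Function.update_of_ne (by omega), hdone i h]
        · rw [Function.update_self, hrest i le_rfl, hrest (wb + i) (hm.le.trans (hd.trans (Nat.le_add_right _ _))), hw i hm.le]
      · rw [Function.update_of_ne (by omega), hrest l (by omega)]
    · rintro τ hF ⟨h18, hdone, hrest⟩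
      refine ⟨?_, hdone⟩
      simp only [Test.holds_lt, Expr.eval_reg, h18, hF.reg 1, hF1.reg 1, h1]
      exact lt_irrefl _
  · simp only [Program.run, Expr.eval_reg, Expr.eval_mul, Expr.eval_div, hF2.reg 25, q1.1,
      hF2.reg 3, hF1.reg 3, h3, hF2.reg 4, hF1.reg 4, h4]
    exact ⟨by simp, q2⟩

end RealRAM

/-! ### Choice of the parameters, and the layout of the input -/

/-- By Bernoulli's inequality the ratio `(m + 1) / m` has a power of at least `2` with the
exponent `m + 1`. -/
theorem mul_pow_lt_pow {m e p : ℕ} (hm : 1 ≤ m) (hp : (m + 1) * (e + 1) ≤ p) :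
    2 ^ e * m ^ p < (m + 1) ^ p := by
  have hbase : 2 * m ^ (m + 1) ≤ (m + 1) ^ (m + 1) := by
    have hm0 : (0 : ℝ) < m := by exact_mod_cast hm
    have h1 := one_add_mul_le_pow (a := 1 / (m : ℝ)) (by
      have : 0 < 1 / (m : ℝ) := by positivity
      linarith) (m + 1)
    have h2 : (2 : ℝ) ≤ (1 + 1 / (m : ℝ)) ^ (m + 1) := by
      refine le_trans ?_ h1
      have : ((m + 1 : ℕ) : ℝ) * (1 / m) = 1 + 1 / m := by push_cast; field_simp
      rw [this]
      have : 0 < 1 / (m : ℝ) := by positivity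
      linarith
    have h3 : ((m : ℝ) + 1) ^ (m + 1) = (1 + 1 / (m : ℝ)) ^ (m + 1) * (m : ℝ) ^ (m + 1) := by
      rw [← mul_pow]; congr 1; field_simp
    have h4 : (2 : ℝ) * (m : ℝ) ^ (m + 1) ≤ ((m : ℝ) + 1) ^ (m + 1) := by
      rw [h3]; gcongr
    exact_mod_cast h4
  obtain ⟨r, rfl⟩ := Nat.exists_eq_add_of_le hp
  have h1 : 2 ^ (e + 1) * m ^ ((m + 1) * (e + 1)) ≤ (m + 1) ^ ((m + 1) * (e + 1)) := by
    rw [pow_mul, pow_mul, ← mul_pow]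
    exact Nat.pow_le_pow_left hbase _
  have h2 : m ^ r ≤ (m + 1) ^ r := Nat.pow_le_pow_left (Nat.le_succ m) r
  have h3 : 0 < m ^ ((m + 1) * (e + 1) + r) := by positivity
  calc 2 ^ e * m ^ ((m + 1) * (e + 1) + r)
      < 2 * (2 ^ e * m ^ ((m + 1) * (e + 1) + r)) := by
        have : 0 < 2 ^ e * m ^ ((m + 1) * (e + 1) + r) := by positivity
        omega
    _ = 2 ^ (e + 1) * m ^ ((m + 1) * (e + 1)) * m ^ r := by rw [pow_add m, pow_succ]; ring
    _ ≤ (m + 1) ^ ((m + 1) * (e + 1)) * (m + 1) ^ r := Nat.mul_le_mul h1 h2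
    _ = _ := (pow_add _ _ _).symm

/-- The least exponent `2 ^ q` for which `B` digits below `2 * n`, raised to that power, have a
sum less than `(2 * n) ^ 2 ^ q`. -/
theorem exists_separating_power {n e m : ℕ} (hn : 1 ≤ n) (hm : 2 * n * (e + 1) ≤ 2 ^ m) :
    ∃ q ≤ m, (∀ k < q, (2 * n) ^ 2 ^ k ≤ 2 ^ e * (2 * n - 1) ^ 2 ^ k) ∧
      2 ^ e * (2 * n - 1) ^ 2 ^ q < (2 * n) ^ 2 ^ q := by
  classical
  have hex : ∃ q, 2 ^ e * (2 * n - 1) ^ 2 ^ q < (2 * n) ^ 2 ^ q := by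
    refine ⟨m, ?_⟩
    have := mul_pow_lt_pow (m := 2 * n - 1) (e := e) (p := 2 ^ m) (by omega)
      (by rwa [Nat.sub_add_cancel (by omega)])
    rwa [Nat.sub_add_cancel (by omega)] at this
  refine ⟨Nat.find hex, Nat.find_min' hex ?_, fun k hk => not_lt.1 (Nat.find_min hex hk),
    Nat.find_spec hex⟩
  have := mul_pow_lt_pow (m := 2 * n - 1) (e := e) (p := 2 ^ m) (by omega)
      (by rwa [Nat.sub_add_cancel (by omega)])
  rwa [Nat.sub_add_cancel (by omega)] at this

theorem exists_grid_exponent {K ε : ℝ} (hε : 0 < ε) :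
    ∃ g : ℕ, (∀ k < g, ((2 ^ k : ℕ) : ℝ) * ε < K) ∧ K ≤ ((2 ^ g : ℕ) : ℝ) * ε := by
  classical
  have hex : ∃ g : ℕ, K ≤ ((2 ^ g : ℕ) : ℝ) * ε := by
    obtain ⟨g, hg⟩ := pow_unbounded_of_one_lt (K / ε) (one_lt_two)
    refine ⟨g, ?_⟩
    rw [div_lt_iff₀ hε] at hg
    push_cast; exact hg.le
  exact ⟨Nat.find hex, fun k hk => not_le.1 (Nat.find_min hex hk), Nat.find_spec hex⟩

section Input

variable {d n : ℕ} (ε : ℝ) (a : Fin d → ℝ) (L : ℝ) (x : Fin n → Fin d → ℝ)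

theorem inputState_mem_corner (i : Fin d) : (inputState ε a L x).mem i = a i := by
  simp [inputState, List.getD_eq_getElem?_getD, List.getElem?_append]

theorem inputState_mem_point (j : Fin n) (i : Fin d) :
    (inputState ε a L x).mem (d + j * d + i) = x j i := by
  have hlt : (j : ℕ) * d + i < n * d := by
    calc (j : ℕ) * d + i < j * d + d := by omega
      _ = (j + 1) * d := by ring
      _ ≤ n * d := Nat.mul_le_mul_right _ j.2
  have hd : 0 < d := lt_of_le_of_lt (Nat.zero_le _) i.2
  have hflat : (List.ofFn fun j => List.ofFn (x j)).flatten =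
      List.ofFn fun k : Fin (n * d) => x k.divNat k.modNat := by
    rw [List.ofFn_mul]
    congr 2
    funext j
    congr 1
    funext i
    congr 1
    · ext
      simp [Fin.divNat, add_comm, mul_comm, Nat.add_mul_div_left _ _ hd, Nat.div_eq_of_lt i.2]
    · ext
      simp [Fin.modNat, Nat.mod_eq_of_lt i.2]
  simp only [inputState, hflat, List.getD_eq_getElem?_getD]
  rw [List.getElem?_append_right (by simp; omega)]
  have h1 : d + (j : ℕ) * d + i - (List.ofFn a).length = j * d + i := by simp; omega
  rw [h1, List.getElem?_eq_getElem (by simpa using hlt)]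
  simp only [List.getElem_ofFn, Option.getD_some]
  congr 1
  · ext
    simp [Fin.divNat, mul_comm _ d, Nat.mul_add_div hd]
  · ext
    simp [Fin.modNat, mul_comm _ d, Nat.mod_eq_of_lt i.2]

end Input

/-! ### The whole program -/

namespace RealRAM

/-- The approximation algorithm. -/
def emptyCubeProg : Program :=
  gridProg ;; sizeProg ;; powerProg ;;
  (13 ≔ (.reg 0 + 1) * .reg 1 ;; 14 ≔ .reg 13 + (.reg 1 + 1) * .reg 6) ;;
  baseProg ;;
  17 ≔ .load (.reg 14 + 2 * .reg 11) ;; tableProg ;; pointProg ;; weightProg ;;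
  digitPowerProg ;;
  (35 ≔ .load (.reg 14) ;; 17 ≔ .reg 35) ;; tableProg ;; searchProg ;;
  outputProg

/-- The registers that are set up in the beginning and keep their contents until the output is
written. -/
structure Setup (n d G H e B A q tb tw : ℕ) (L : ℝ) (σ : State) : Prop where
  r0 : σ.reg 0 = n
  r1 : σ.reg 1 = d
  r3 : σ.reg 3 = L
  r4 : σ.reg 4 = G
  r6 : σ.reg 6 = H
  r7 : σ.reg 7 = e
  r8 : σ.reg 8 = B
  r9 : σ.reg 9 = A
  r11 : σ.reg 11 = q
  r13 : σ.reg 13 = tb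
  r14 : σ.reg 14 = tw

theorem Setup.of_frame {n d G H e B A q tb tw : ℕ} {L : ℝ} {σ τ : State} {P : Program}
    (h : Setup n d G H e B A q tb tw L σ) (hF : Frame P σ τ)
    (hP : ∀ r ∈ [0, 1, 3, 4, 6, 7, 8, 9, 11, 13, 14], r ∉ P.writes := by decide) :
    Setup n d G H e B A q tb tw L τ where
  r0 := by rw [hF.reg 0 (hP 0 (by decide)), h.r0]
  r1 := by rw [hF.reg 1 (hP 1 (by decide)), h.r1]
  r3 := by rw [hF.reg 3 (hP 3 (by decide)), h.r3]
  r4 := by rw [hF.reg 4 (hP 4 (by decide)), h.r4]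
  r6 := by rw [hF.reg 6 (hP 6 (by decide)), h.r6]
  r7 := by rw [hF.reg 7 (hP 7 (by decide)), h.r7]
  r8 := by rw [hF.reg 8 (hP 8 (by decide)), h.r8]
  r9 := by rw [hF.reg 9 (hP 9 (by decide)), h.r9]
  r11 := by rw [hF.reg 11 (hP 11 (by decide)), h.r11]
  r13 := by rw [hF.reg 13 (hP 13 (by decide)), h.r13]
  r14 := by rw [hF.reg 14 (hP 14 (by decide)), h.r14]

/-- `emptyCubeProg` finds the last full position `u₀` and outputs the cube that it encodes. -/
theorem emptyCubeProg_runs {n d g q u₀ : ℕ} {ε L : ℝ} {c : ℕ → ℕ → ℕ} {σ : State}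
    (hn : 1 ≤ n) (h0 : σ.reg 0 = n) (h1 : σ.reg 1 = d) (h2 : σ.reg 2 = ε) (h3 : σ.reg 3 = L)
    (hglt : ∀ k < g, ((2 ^ k : ℕ) : ℝ) * ε < 2 * d * (n + 1))
    (hgge : 2 * d * (n + 1) ≤ ((2 ^ g : ℕ) : ℝ) * ε)
    (hqle : ∀ k < q, (2 * n) ^ 2 ^ k ≤ 2 ^ ((g + 1) * (d + 1)) * (2 * n - 1) ^ 2 ^ k)
    (hqgt : 2 ^ ((g + 1) * (d + 1)) * (2 * n - 1) ^ 2 ^ q < (2 * n) ^ 2 ^ q)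
    (hc : ∀ j < n, ∀ i < d, c j i ≤ 2 ^ g ∧
      ((⌊(σ.mem (d + j * d + i) - σ.mem i) * ((2 ^ g : ℕ) : ℝ) / L⌋ : ℤ) : ℝ) = c j i)
    (hu₀ : u₀ < (2 * 2 ^ g) ^ (d + 1)) (hfull : Full n d (2 ^ g) (2 * 2 ^ g) c u₀)
    (hmax : ∀ u < (2 * 2 ^ g) ^ (d + 1), Full n d (2 ^ g) (2 * 2 ^ g) c u → u ≤ u₀) :
    Runs emptyCubeProg σ
      (2000 * ((d + 1) * (2 * 2 ^ g) + n * (d + 1) + q * ((g + 1) * (d + 1)) + q + 1))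
      (fun τ => τ.reg 0 = ((u₀ / (2 * 2 ^ g) ^ d : ℕ) : ℝ) * L / ((2 ^ g : ℕ) : ℝ) ∧
        ∀ i < d, τ.mem i = σ.mem i + (((u₀ / (2 * 2 ^ g) ^ i % (2 * 2 ^ g) : ℕ) : ℝ) -
          (((u₀ / (2 * 2 ^ g) ^ d : ℕ) : ℝ) - 1)) * L / ((2 ^ g : ℕ) : ℝ)) := by
  obtain ⟨G, hG⟩ : ∃ G, G = 2 ^ g := ⟨_, rfl⟩
  obtain ⟨H, hH⟩ : ∃ H, H = 2 * G := ⟨_, rfl⟩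
  obtain ⟨e, he⟩ : ∃ e, e = (g + 1) * (d + 1) := ⟨_, rfl⟩
  obtain ⟨A, hA⟩ : ∃ A, A = (2 * n) ^ 2 ^ q := ⟨_, rfl⟩
  obtain ⟨B, hB⟩ : ∃ B, B = H ^ (d + 1) := ⟨_, rfl⟩
  have hBe : B = 2 ^ e := by
    rw [hB, hH, hG, he, ← pow_succ', ← pow_mul]
  have hG1 : 1 ≤ G := hG ▸ Nat.one_le_two_pow
  have hA1 : 1 ≤ A := hA ▸ Nat.one_le_pow _ _ (by omega)
  have hB2 : 2 ≤ B := by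
    rw [hB]; exact le_trans (by omega : 2 ≤ H) (Nat.le_self_pow (by omega) H)
  rw [← he, ← hBe] at hqle hqgt
  rw [← hG] at hc hu₀ hfull hmax hgge ⊢
  rw [← hH] at hu₀ hfull hmax ⊢
  rw [← he]
  set tb := (n + 1) * d with htb
  set tw := tb + (d + 1) * H with htw
  have hg : g ≤ G := hG ▸ Nat.lt_two_pow_self.le
  -- the sizes
  refine Runs.seq (gridProg_runs h0 h1 h2 hglt (hG ▸ hgge))
    (T₂ := e * 150 + q * 600 + 2 * q * (e * 150) + (d + 1) * (H * 150) * 3 + (d + 1) * 500 +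
      n * (d * 150) + n * 150 + G * (d * 250) + G * 200 + d * 150 + 1110)
    (fun σ₁ F₁ p₁ => ?_) ?_
  · refine Runs.seq (sizeProg_runs (d := d) (g := g) ?_ p₁.1 p₁.2)
      (T₂ := q * 600 + 2 * q * (e * 150) + (d + 1) * (H * 150) * 3 + (d + 1) * 500 +
      n * (d * 150) + n * 150 + G * (d * 250) + G * 200 + d * 150 + 1030)
      (fun σ₂ F₂ p₂ => ?_) ?_
    · rw [F₁.reg 1, h1]
    · rw [← he, ← hBe, ← hG, ← hH] at p₂
      refine Runs.seq (powerProg_runs (n := n) (B := B) (q := q) hn ?_ p₂.2.2 hqle hqgt)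
        (T₂ := q * 450 + 2 * q * (e * 150) + (d + 1) * (H * 150) * 3 + (d + 1) * 500 +
          n * (d * 150) + n * 150 + G * (d * 250) + G * 200 + d * 150 + 950)
        (fun σ₃ F₃ p₃ => ?_) (by omega)
      · rw [F₂.reg 0, F₁.reg 0, h0]
      rw [← hA] at p₃
      have e0 : σ₃.reg 0 = n := by rw [F₃.reg 0, F₂.reg 0, F₁.reg 0, h0]
      have e1 : σ₃.reg 1 = d := by rw [F₃.reg 1, F₂.reg 1, F₁.reg 1, h1]
      have e6 : σ₃.reg 6 = H := by rw [F₃.reg 6, p₂.1]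
      refine Runs.seq (T₁ := 30)
        (T₂ := q * 450 + 2 * q * (e * 150) + (d + 1) * (H * 150) * 3 + (d + 1) * 500 +
          n * (d * 150) + n * 150 + G * (d * 250) + G * 200 + d * 150 + 920)
        (Q₁ := fun τ => Setup n d G H e B A q tb tw L τ ∧ τ.mem = σ.mem) (Runs.straight ?_)
        (fun σ₄ F₄ p₄ => ?_) (by omega)
      · refine ⟨⟨?_, ?_, ?_, ?_, ?_, ?_, ?_, ?_, ?_, ?_, ?_⟩, ?_⟩
        · simp [Program.run, e0]
        · simp [Program.run, e1]
        · simp [Program.run, F₃.reg 3, F₂.reg 3, F₁.reg 3, h3]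
        · simp [Program.run, F₃.reg 4, F₂.reg 4, p₁.1, hG]
        · simp [Program.run, e6]
        · simp [Program.run, F₃.reg 7, p₂.2.1]
        · simp [Program.run, F₃.reg 8, p₂.2.2]
        · simp [Program.run, p₃.1]
        · simp [Program.run, p₃.2]
        · simp [Program.run, e0, e1, htb]
        · simp [Program.run, e0, e1, e6, htw, htb]
        · simp [Program.run, F₃.mem, F₂.mem, F₁.mem]
      obtain ⟨S₄, M₄⟩ := p₄
      -- the tower of bases
      refine Runs.seq (baseProg_runs (e := e) (q := q) (A := A) (tw := tw) S₄.r7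
        (by rw [← hBe]; exact S₄.r8) S₄.r9 S₄.r11 S₄.r14)
        (T₂ := (d + 1) * (H * 150) * 3 + (d + 1) * 500 + q * 150 +
          n * (d * 150) + n * 150 + G * (d * 250) + G * 200 + d * 150 + 820)
        (fun σ₅ F₅ p₅ => ?_) (by rw [Nat.mul_add]; omega)
      have S₅ := S₄.of_frame F₅
      rw [← hBe, M₄] at p₅
      obtain ⟨hbase, hlow₅⟩ := p₅
      -- the generating function of the weights
      have hX : 1 < base B A (2 * q) := lt_of_lt_of_le
        (by rw [base, pow_zero, pow_one]; nlinarith [Nat.mul_le_mul hB2 hB2])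
        (base_le_base (m := 0) (by omega) hA1 (Nat.zero_le _))
      have haddr₅ : ⌊σ₅.reg 14 + 2 * σ₅.reg 11⌋₊ = tw + 2 * q :=
        floor_eq_of_eq (by rw [S₅.r14, S₅.r11]; push_cast; rfl)
      refine Runs.seq (T₁ := 20) (T₂ := (d + 1) * (H * 150) * 3 + (d + 1) * 500 + q * 150 +
          n * (d * 150) + n * 150 + G * (d * 250) + G * 200 + d * 150 + 800)
        (Q₁ := fun τ => τ.reg 17 = (base B A (2 * q) : ℝ))
        (Runs.straight (by simp [Program.run, haddr₅, hbase])) (fun σ₆ F₆ p₆ => ?_) (by omega)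
      have S₆ := S₅.of_frame F₆
      refine Runs.seq (tableProg_runs S₆.r1 S₆.r6 S₆.r13 p₆)
        (T₂ := (d + 1) * (H * 150) * 2 + (d + 1) * 350 + q * 150 +
          n * (d * 150) + n * 150 + G * (d * 250) + G * 200 + d * 150 + 720)
        (fun σ₇ F₇ p₇ => ?_) (by rw [Nat.mul_add]; omega)
      have S₇ := S₆.of_frame F₇
      obtain ⟨htab₇, h20₇, hlow₇, hhigh₇⟩ := p₇
      rw [F₆.mem] at hlow₇ hhigh₇
      have hin : ∀ k < tb, σ₇.mem k = σ.mem k := fun k hk => by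
        rw [hlow₇ k hk, hlow₅ k (by omega)]
      have h17₇ : σ₇.reg 17 = (base B A (2 * q) : ℝ) := by rw [F₇.reg 17, p₆]
      refine Runs.seq (pointProg_runs (c := c) S₇.r0 S₇.r1 S₇.r3 S₇.r4 S₇.r6 S₇.r13 htab₇ ?_)
        (T₂ := (d + 1) * (H * 150) * 2 + (d + 1) * 350 + q * 150 +
          G * (d * 250) + G * 200 + d * 150 + 640)
        (fun σ₈ F₈ p₈ => ?_) (by rw [Nat.mul_add n]; omega)
      · intro j hj i hi
        have hlt : d + j * d + i < tb := by
          have : (j + 1) * d ≤ n * d := Nat.mul_le_mul_right _ hj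
          rw [htb, Nat.succ_mul]; rw [Nat.succ_mul] at this; omega
        rw [hin _ hlt, hin i (by omega)]
        exact ⟨by have := (hc j hj i hi).1; omega, (hc j hj i hi).2⟩
      have S₈ := S₇.of_frame F₈
      refine Runs.seq (weightProg_runs (x := base B A (2 * q)) hH hG1 S₈.r0 S₈.r1 S₈.r4 S₈.r6
        S₈.r13 (by rw [F₈.reg 17, h17₇]) (by rw [F₈.reg 20, h20₇])
        (by intro i hi k hk; rw [F₈.mem]; exact htab₇ i hi k hk))
        (T₂ := (d + 1) * (H * 150) * 2 + (d + 1) * 350 + q * 150 + d * 150 + 520)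
        (fun σ₉ F₉ p₉ => ?_) (by rw [Nat.mul_add G]; omega)
      rw [p₈, ← packed_weight hH hG1 (fun j hj i hi => (hc j hj i hi).1) hX, ← hB] at p₉
      have S₉ := S₈.of_frame F₉
      have hhigh₉ : ∀ k, tw ≤ k → σ₉.mem k = σ₅.mem k := fun k hk => by
        rw [F₉.mem, F₈.mem, hhigh₇ k hk]
      -- the powers of the digits
      refine Runs.seq (digitPowerProg_runs (N := 2 * n) (q := q) (tw := tw) hB2 (by omega) hA
        (fun u _ => weight_le n d G H c u) S₉.r11 S₉.r14 p₉
        (fun m hm => by rw [hhigh₉ _ (by omega), hbase m hm]))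
        (T₂ := (d + 1) * (H * 150) * 2 + (d + 1) * 350 + d * 150 + 460)
        (fun σ₁₀ F₁₀ p₁₀ => ?_) (by omega)
      have S₁₀ := S₉.of_frame F₁₀
      have hm0 : σ₁₀.mem tw = base B A 0 := by
        rw [F₁₀.mem, hhigh₉ _ le_rfl]; exact hbase 0 (by omega)
      have haddr₁₀ : ⌊σ₁₀.reg 14⌋₊ = tw := floor_eq_of_eq S₁₀.r14
      refine Runs.seq (T₁ := 20) (T₂ := (d + 1) * (H * 150) * 2 + (d + 1) * 350 + d * 150 + 440)
        (Q₁ := fun τ => τ.reg 35 = (base B A 0 : ℝ) ∧ τ.reg 17 = (base B A 0 : ℝ))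
        (Runs.straight (by simp [Program.run, haddr₁₀, hm0])) (fun σ₁₁ F₁₁ p₁₁ => ?_) (by omega)
      have S₁₁ := S₁₀.of_frame F₁₁
      refine Runs.seq (tableProg_runs S₁₁.r1 S₁₁.r6 S₁₁.r13 p₁₁.2)
        (T₂ := (d + 1) * (H * 150) + (d + 1) * 200 + d * 150 + 360)
        (fun σ₁₂ F₁₂ p₁₂ => ?_) (by rw [Nat.mul_add]; omega)
      have S₁₂ := S₁₁.of_frame F₁₂
      obtain ⟨htab₁₂, -, hlow₁₂, -⟩ := p₁₂
      -- the search
      refine Runs.seq (searchProg_runs (b := fun u => weight n d G H c u ^ 2 ^ q)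
        (Y := base B A 0) (u₀ := u₀) (tb := tb) (tw := tw) (A := A) (q := q) (by omega) hA1
        ?_ ?_ ?_ hu₀ ?_ ?_ S₁₂.r1 S₁₂.r6 S₁₂.r9
        S₁₂.r11 S₁₂.r13 S₁₂.r14 le_rfl (by rw [F₁₂.reg 35, p₁₁.1])
        (by rw [F₁₂.reg 30, F₁₁.reg 30, p₁₀, hB]) htab₁₂)
        (T₂ := d * 150 + 100) (fun σ₁₃ F₁₃ p₁₃ => ?_) (by rw [Nat.mul_add]; omega)
      · rw [← hB, base, pow_zero, pow_one]
        have : 2 * (B * A) ≤ B * (B * A) := Nat.mul_le_mul_right _ hB2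
        have : 2 * 1 ≤ B * A := Nat.mul_le_mul hB2 hA1
        nlinarith
      · exact fun u _ => hA ▸ Nat.pow_le_pow_left (weight_le n d G H c u) _
      · intro u _ hlt
        have hw : weight n d G H c u ≤ 2 * n - 1 := by
          by_contra hgt
          have h4 := weight_le n d G H c u
          have h5 : weight n d G H c u = 2 * n := by omega
          rw [h5, hA] at hlt
          exact lt_irrefl _ hlt
        rw [← hB, hA]
        exact lt_of_le_of_lt (Nat.mul_le_mul_left _ (Nat.pow_le_pow_left hw _)) hqgt
      · simp only [(weight_eq_iff hn c u₀).2 hfull, hA]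
      · intro u hu hbu
        refine hmax u hu ((weight_eq_iff hn c u).1 ?_)
        rw [hA] at hbu
        exact Nat.pow_left_injective (n := 2 ^ q) (by positivity) hbu
      have S₁₃ := S₁₂.of_frame F₁₃
      obtain ⟨h36, hdig, hlow₁₃⟩ := p₁₃
      refine (outputProg_runs (wb := tw + 2 * q + 1)
        (w := fun i => ((u₀ / H ^ i % H : ℕ) : ℝ)) ?_ S₁₃.r1 S₁₃.r3 S₁₃.r4 h36 hdig).mono le_rfl
        (fun τ _ hτ => ?_)
      · rw [htw, htb, Nat.succ_mul]; omega
      have hs : u₀ / H ^ d % H = u₀ / H ^ d := Nat.mod_eq_of_lt (by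
        rw [Nat.div_lt_iff_lt_mul (by apply pow_pos; omega)]; rwa [pow_succ, mul_comm] at hu₀)
      simp only [hs] at hτ
      refine ⟨hτ.1, fun i hi => ?_⟩
      have hitb : i < tb := by rw [htb, Nat.succ_mul]; omega
      rw [hτ.2 i hi, hlow₁₃ i (by omega), hlow₁₂ i hitb, F₁₁.mem, F₁₀.mem, F₉.mem, F₈.mem,
        hin i hitb]
    · rw [← he]; omega
  · have hGd : G * d ≤ (d + 1) * H := by
      rw [hH]; nlinarith
    have hGD : H ≤ (d + 1) * H := Nat.le_mul_of_pos_left _ (by omega)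
    have hdD : d + 1 ≤ (d + 1) * H := Nat.le_mul_of_pos_right _ (by omega)
    have heD : e ≤ (d + 1) * H := by
      have h1 : g + 1 ≤ 2 ^ g := Nat.lt_two_pow_self
      rw [he, mul_comm]
      exact Nat.mul_le_mul_left _ (by omega)
    have a1 : (d + 1) * (H * 150) = 150 * ((d + 1) * H) := by ring
    have a2 : n * (d * 150) + n * 150 = 150 * (n * (d + 1)) := by ring
    have a3 : G * (d * 250) = 250 * (G * d) := by ring
    have a4 : 2 * q * (e * 150) = 300 * (q * e) := by ring
    rw [a1, a3, a4]
    omega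

end RealRAM

/-! ### The approximation guarantee and the running time -/

theorem theorem6 :
    ∃ (P : RealRAM.Program) (C : ℝ),
      ∀ (d n : ℕ) (ε : ℝ) (a : Fin d → ℝ) (L : ℝ) (x : Fin n → Fin d → ℝ),
        1 ≤ d → 2 ≤ n → 0 < ε → ε < 1 → 0 < L → (∀ j, x j ∈ closedCube a L) →
        ∃ (τ : RealRAM.State) (t : ℕ),
          RealRAM.Exec P (inputState ε a L x) τ t ∧
          IsApproxMaxEmptyHypercube ε a L x (outputCorner d τ) (outputSide τ) ∧
          (t : ℝ) ≤ C * ((d : ℝ) ^ 2 / ε * ((n : ℝ) * Real.logb 2 n) +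
            (4 * (d : ℝ) / ε) ^ (d + 1) * ((n : ℝ) ^ ((1 : ℝ) / (d : ℝ)) * Real.logb 2 n)) := by
  classical
  refine ⟨RealRAM.emptyCubeProg, 2000 * (13 * 24), ?_⟩
  intro d n ε a L x hd hn hε hε1 hL hx
  have hd' : (1 : ℝ) ≤ d := by exact_mod_cast hd
  have hn' : (2 : ℝ) ≤ n := by exact_mod_cast hn
  obtain ⟨g, hglt, hgge⟩ := exists_grid_exponent (K := 2 * d * ((n : ℝ) + 1)) hε
  obtain ⟨G, hG⟩ : ∃ G, G = 2 ^ g := ⟨_, rfl⟩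
  obtain ⟨H, hH⟩ : ∃ H, H = 2 * G := ⟨_, rfl⟩
  have hG1 : 1 ≤ G := hG ▸ Nat.one_le_two_pow
  have hgge' : 2 * d * ((n : ℝ) + 1) ≤ (G : ℝ) * ε := hG ▸ hgge
  have hGn : 2 * d * (n + 1) ≤ G := by
    have hG0 : (0 : ℝ) < G := by exact_mod_cast hG1
    have : 2 * (d : ℝ) * (n + 1) ≤ G := hgge'.trans (by nlinarith)
    exact_mod_cast this
  have hHg : H = 2 ^ (g + 1) := by rw [hH, hG, pow_succ']
  have hgG : g + 1 ≤ G := hG ▸ Nat.lt_two_pow_self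
  have hndH : 2 * (n * (d + 1)) ≤ H := by
    have : n * 1 ≤ n * d := Nat.mul_le_mul_left _ hd
    have h2 : 2 * d * (n + 1) = 2 * (n * d) + 2 * d := by ring
    have h3 : n * (d + 1) = n * d + n := by ring
    omega
  -- the number of squarings
  obtain ⟨q, hqm, hqle, hqgt⟩ := exists_separating_power (n := n) (e := (g + 1) * (d + 1))
    (m := 2 * (g + 1) + 1) (by omega) (by
      calc 2 * n * ((g + 1) * (d + 1) + 1) ≤ 2 * n * (2 * ((g + 1) * (d + 1))) := by
            refine Nat.mul_le_mul_left _ ?_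
            have : 1 * 1 ≤ (g + 1) * (d + 1) := Nat.mul_le_mul (by omega) (by omega)
            omega
        _ = 2 * (2 * (n * (d + 1))) * (g + 1) := by ring
        _ ≤ 2 * H * H := Nat.mul_le_mul (Nat.mul_le_mul_left _ hndH) (by omega)
        _ = 2 ^ (2 * (g + 1) + 1) := by rw [hHg]; ring)
  -- the cells of the points
  set σ := inputState ε a L x with hσ
  let c : ℕ → ℕ → ℕ := fun j i => ⌊(σ.mem (d + j * d + i) - σ.mem i) * (G : ℝ) / L⌋₊
  have hc : ∀ (j : Fin n) (i : Fin d), c j i = ⌊(x j i - a i) * G / L⌋₊ := fun j i => by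
    simp only [c, hσ, inputState_mem_point, inputState_mem_corner]
  obtain ⟨u₀, hu₀mem, hmax⟩ := Finset.exists_max_image
    ((Finset.range (H ^ (d + 1))).filter (fun u => Full n d G H c u)) id (by
      obtain ⟨u, hu, hf⟩ := exists_full hL hH hG1 hd hε hε1 hgge' hx hc
      exact ⟨u, Finset.mem_filter.2 ⟨Finset.mem_range.2 hu, hf⟩⟩)
  obtain ⟨hu₀, hfull⟩ := Finset.mem_filter.1 hu₀mem
  rw [Finset.mem_range] at hu₀
  have hmax' : ∀ u < H ^ (d + 1), Full n d G H c u → u ≤ u₀ := fun u hu hf =>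
    hmax u (Finset.mem_filter.2 ⟨Finset.mem_range.2 hu, hf⟩)
  obtain ⟨τ, t, hE, ht, hside, hcorner⟩ := RealRAM.emptyCubeProg_runs (n := n) (d := d) (g := g)
    (q := q) (u₀ := u₀) (ε := ε) (L := L) (c := c) (σ := σ) (by omega) (by simp [hσ, inputState])
    (by simp [hσ, inputState]) (by simp [hσ, inputState]) (by simp [hσ, inputState]) hglt hgge
    hqle hqgt (by
      rw [← hG]
      intro j hj i hi
      have h1 : σ.mem (d + j * d + i) = x ⟨j, hj⟩ ⟨i, hi⟩ :=
        inputState_mem_point ε a L x ⟨j, hj⟩ ⟨i, hi⟩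
      have h2 : σ.mem i = a ⟨i, hi⟩ := inputState_mem_corner ε a L x ⟨i, hi⟩
      obtain ⟨h3, h4⟩ := hx ⟨j, hj⟩ ⟨i, hi⟩
      have h5 : 0 ≤ (σ.mem (d + j * d + i) - σ.mem i) * (G : ℝ) / L := by
        rw [h1, h2]
        exact div_nonneg (mul_nonneg (by linarith) (by positivity)) hL.le
      refine ⟨?_, ?_⟩
      · refine Nat.floor_le_of_le ?_
        rw [h1, h2, div_le_iff₀ hL, mul_comm]
        exact mul_le_mul_of_nonneg_left (by linarith) (by positivity)
      · exact (natCast_floor_eq_intCast_floor h5).symm)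
    (by rw [← hG, ← hH]; exact hu₀) (by rw [← hG, ← hH]; exact hfull)
    (by rw [← hG, ← hH]; exact hmax')
  rw [← hG, ← hH] at hside hcorner ht
  refine ⟨τ, t, hE, ?_, ?_⟩
  · have hco : outputCorner d τ = fun i : Fin d => a i + (((u₀ / H ^ (i : ℕ) % H : ℕ) : ℝ) -
        (((u₀ / H ^ d : ℕ) : ℝ) - 1)) * L / G := by
      funext i
      rw [outputCorner, hcorner i i.2, hσ, inputState_mem_corner]
    rw [hco, outputSide, hside]
    exact isApproxMaxEmptyHypercube_of_full hL hH hG1 hd hε hε1 hgge' hx hc hfull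
      fun u hu hf => Nat.div_le_div_right (hmax' u hu hf)
  · have hsq : ∀ k : ℕ, (k + 1) * (k + 1) ≤ 2 * 2 ^ (k + 1) := by
      intro k
      induction k with
      | zero => norm_num
      | succ k ih =>
        rcases Nat.lt_or_ge k 2 with h | h
        · interval_cases k <;> norm_num
        · rw [pow_succ]; nlinarith
    have hqe : q * ((g + 1) * (d + 1)) ≤ 6 * ((d + 1) * H) := by
      calc q * ((g + 1) * (d + 1)) ≤ (3 * (g + 1)) * ((g + 1) * (d + 1)) :=
            Nat.mul_le_mul_right _ (by omega)
        _ = 3 * (d + 1) * ((g + 1) * (g + 1)) := by ring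
        _ ≤ 3 * (d + 1) * (2 * H) := Nat.mul_le_mul_left _ (hHg ▸ hsq g)
        _ = _ := by ring
    have hHD : H ≤ (d + 1) * H := Nat.le_mul_of_pos_left _ (by omega)
    have htD : t ≤ 2000 * (13 * ((d + 1) * H)) := ht.trans (by omega)
    -- the previous power of two is too coarse, so that the grid is not too fine
    have hGup : (G : ℝ) * ε ≤ 6 * d * n := by
      obtain ⟨g', rfl⟩ : ∃ g', g = g' + 1 := by
        refine ⟨g - 1, (Nat.sub_add_cancel ?_).symm⟩
        by_contra h0
        obtain rfl : g = 0 := by omega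
        rw [hG] at hGn
        have : 1 * 1 ≤ d * (n + 1) := Nat.mul_le_mul hd (by omega)
        rw [mul_assoc] at hGn
        omega
      have h1 := hglt g' (by omega)
      have h2 : (G : ℝ) = 2 * ((2 ^ g' : ℕ) : ℝ) := by rw [hG, pow_succ']; push_cast; ring
      rw [h2]
      nlinarith
    have hlog : 1 ≤ Real.logb 2 n := by
      rw [Real.le_logb_iff_rpow_le (by norm_num) (by linarith)]
      simpa using hn'
    have hDr : (((d + 1) * H : ℕ) : ℝ) ≤ 24 * ((d : ℝ) ^ 2 / ε * n) := by
      have hG' : (G : ℝ) ≤ 6 * d * n / ε := by rwa [le_div_iff₀ hε]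
      rw [hH]
      push_cast
      calc ((d : ℝ) + 1) * (2 * G) ≤ (2 * d) * (2 * (6 * d * n / ε)) := by gcongr; linarith
        _ = 24 * ((d : ℝ) ^ 2 / ε * n) := by ring
    have hfirst : (d : ℝ) ^ 2 / ε * n ≤ (d : ℝ) ^ 2 / ε * ((n : ℝ) * Real.logb 2 n) := by
      gcongr
      exact le_mul_of_one_le_right (by linarith) hlog
    have hsecond : 0 ≤ (4 * (d : ℝ) / ε) ^ (d + 1) *
        ((n : ℝ) ^ ((1 : ℝ) / (d : ℝ)) * Real.logb 2 n) := by positivity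
    calc (t : ℝ) ≤ ((2000 * (13 * ((d + 1) * H)) : ℕ) : ℝ) := by exact_mod_cast htD
      _ = 2000 * 13 * (((d + 1) * H : ℕ) : ℝ) := by push_cast; ring
      _ ≤ 2000 * 13 * (24 * ((d : ℝ) ^ 2 / ε * n)) := by gcongr
      _ ≤ _ := by linarith
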